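/- **Theorem 5.** Let $D=(V,A)$ be a digraph without loops and without multiple arcs. For a vertex $v$ let $N^-(v)=\{u\in V:(u,v)\in A\}$ and $N^-[v]=\{v\}\cup N^-(v)$, and for $U\subseteq V$ let $N^-[U]=\bigcup_{u\in U}N^-[u]$. A set $C\subseteq V$ is a $(1,\le \ell)$-identifying code in $D$ if $N^-[X]\cap C\ne N^-[Y]\cap C$ for all distinct $X,Y\subseteq V$ with $1\le |X|,|Y|\le \ell$. Assume that $D$ is 2-in-regular, that is, $|N^-(v)|=2$ for every $v\in V$. Then $D$ has a $(1,\le 3)$-identifying code if and only if $D$ is an oriented graph (there are no two opposite arcs $(u,v),(v,u)$), $D$ is $TT_3$-free (it has no subdigraph isomorphic to the transitive tournament on three vertices), and $D$ contains no (not necessarily induced) subdigraph isomorphic to one of the following fifteen digraphs, each given by its list of arcs, where $a\to b$ is the arc from $a$ to $b$: - $J_{1}$ on $\{0,\dots,4\}$: $3\to 0$, $4\to 0$, $3\to 1$, $4\to 1$, $0\to 2$; - $J_{2}$ on $\{0,\dots,4\}$: $1\to 0$, $2\to 0$, $3\to 1$, $4\to 1$, $4\to 2$, $0\to 3$; - $J_{3}$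 on $\{0,\dots,4\}$: $1\to 0$, $4\to 0$, $2\to 1$, $3\to 1$, $0\to 2$, $4\to 3$; - $J_{4}$ on $\{0,\dots,4\}$: $2\to 0$, $4\to 0$, $3\to 1$, $4\to 1$, $1\to 2$, $0\to 3$; - $J_{5}$ on $\{0,\dots,5\}$: $1\to 0$, $4\to 0$, $3\to 1$, $5\to 1$, $4\to 2$, $5\to 2$, $2\to 3$; - $J_{6}$ on $\{0,\dots,5\}$: $1\to 0$, $2\to 0$, $3\to 1$, $4\to 1$, $4\to 2$, $5\to 2$, $5\to 3$; - $J_{7}$ on $\{0,\dots,5\}$: $1\to 0$, $4\to 0$, $2\to 1$, $5\to 1$, $3\to 2$, $4\to 2$, $5\to 3$; - $J_{8}$ on $\{0,\dots,5\}$: $1\to 0$, $3\to 0$, $4\to 1$, $5\to 1$, $0\to 2$, $4\to 2$, $5\to 3$; - $J_{9}$ on $\{0,\dots,5\}$: $1\to 0$, $4\to 0$, $3\to 1$, $5\to 1$, $4\to 2$, $5\to 2$, $0\to 3$; - $J_{10}$ on $\{0,\dots,6\}$: $1\to 0$, $4\to 0$, $2\to 1$, $5\to 1$, $4\to 2$,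 $6\to 2$, $5\to 3$, $6\to 3$; - $J_{11}$ on $\{0,\dots,6\}$: $1\to 0$, $2\to 0$, $4\to 1$, $5\to 1$, $4\to 2$, $6\to 2$, $5\to 3$, $6\to 3$; - $J_{12}$ on $\{0,\dots,6\}$: $1\to 0$, $4\to 0$, $5\to 1$, $6\to 1$, $3\to 2$, $5\to 2$, $4\to 3$, $6\to 3$; - $J_{13}$ on $\{0,\dots,8\}$: $3\to 0$, $6\to 0$, $4\to 1$, $7\to 1$, $5\to 2$, $8\to 2$, $1\to 3$, $8\to 3$, $2\to 4$, $6\to 4$, $0\to 5$, $7\to 5$; - $J_{14}$ on $\{0,\dots,8\}$: $3\to 0$, $4\to 0$, $5\to 1$, $6\to 1$, $7\to 2$, $8\to 2$, $1\to 3$, $7\to 3$, $2\to 4$, $6\to 4$, $0\to 5$, $8\to 5$; - $J_{15}$ on $\{0,\dots,8\}$: $3\to 0$, $4\to 0$, $5\to 1$, $6\to 1$, $7\to 2$, $8\to 2$, $1\to 3$, $2\to 3$, $6\to 4$, $7\to 4$, $0\to 5$, $8\to 5$. -/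

import Mathlib

/-- The in-neighbourhood `N⁻(v)`: the set of all `u` such that `(u, v)` is an arc. -/
def Digraph.inNbr {V : Type*} (D : Digraph V) (v : V) : Set V := {u | D.Adj u v}

/-- The closed in-neighbourhood `N⁻[v] = {v} ∪ N⁻(v)` of a vertex. -/
def Digraph.closedInNbr {V : Type*} (D : Digraph V) (v : V) : Set V := {v} ∪ D.inNbr v

/-- The closed in-neighbourhood `N⁻[U] = ⋃ u ∈ U, N⁻[u]` of a set of vertices. -/
def Digraph.closedInNbrs {V : Type*} (D : Digraph V) (U : Set V) : Set V :=
  ⋃ u ∈ U, D.closedInNbr u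

/-- No vertex carries a loop. (Multiple arcs are excluded by the type `Digraph` itself.) -/
def Digraph.IsLoopless {V : Type*} (D : Digraph V) : Prop := ∀ v, ¬ D.Adj v v

/-- `D` is `d`-in-regular: every vertex has in-degree exactly `d`. -/
def Digraph.IsInRegular {V : Type*} (D : Digraph V) (d : ℕ) : Prop :=
  ∀ v, (D.inNbr v).encard = d

/-- `D` is an oriented graph: it has no digon, i.e. no two opposite arcs. -/
def Digraph.IsOriented {V : Type*} (D : Digraph V) : Prop :=
  ∀ u v, D.Adj u v → ¬ D.Adj v u

/-- `C` is a `(1, ≤ ℓ)`-identifying code in `D`: any two distinct sets `X`, `Y` of vertices of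
cardinality between `1` and `ℓ` have distinct closed in-neighbourhoods within `C`. -/
def Digraph.IsIdentifyingCode {V : Type*} (D : Digraph V) (ℓ : ℕ) (C : Set V) : Prop :=
  ∀ X Y : Finset V, X ≠ Y → 1 ≤ X.card → X.card ≤ ℓ → 1 ≤ Y.card → Y.card ≤ ℓ →
    D.closedInNbrs ↑X ∩ C ≠ D.closedInNbrs ↑Y ∩ C

/-- `D` has a `(1, ≤ ℓ)`-identifying code. -/
def Digraph.HasIdentifyingCode {V : Type*} (D : Digraph V) (ℓ : ℕ) : Prop :=
  ∃ C : Set V, D.IsIdentifyingCode ℓ C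

/-- `D` contains a (not necessarily induced) subdigraph isomorphic to `H`. -/
def Digraph.ContainsCopy {V W : Type*} (D : Digraph V) (H : Digraph W) : Prop :=
  ∃ f : W → V, Function.Injective f ∧ ∀ a b, H.Adj a b → D.Adj (f a) (f b)

namespace InRegularCode

/-- The digraph on `{0, …, n - 1}` whose arcs are the pairs in the list `l`. -/
def ofArcs {n : ℕ} (l : List (Fin n × Fin n)) : Digraph (Fin n) where
  Adj a b := (a, b) ∈ l

/-- The transitive tournament on three vertices. -/
def TT3 : Digraph (Fin 3) :=
  ofArcs [(0, 1), (0, 2), (1, 2)]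

-- The fifteen forbidden digraphs; each pair `(a, b)` is an arc from `a` to `b`. 

def J1 : Digraph (Fin 5) :=
  ofArcs [(3, 0), (4, 0), (3, 1), (4, 1), (0, 2)]

def J2 : Digraph (Fin 5) :=
  ofArcs [(1, 0), (2, 0), (3, 1), (4, 1), (4, 2), (0, 3)]

def J3 : Digraph (Fin 5) :=
  ofArcs [(1, 0), (4, 0), (2, 1), (3, 1), (0, 2), (4, 3)]

def J4 : Digraph (Fin 5) :=
  ofArcs [(2, 0), (4, 0), (3, 1), (4, 1), (1, 2), (0, 3)]

def J5 : Digraph (Fin 6) :=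
  ofArcs [(1, 0), (4, 0), (3, 1), (5, 1), (4, 2), (5, 2), (2, 3)]

def J6 : Digraph (Fin 6) :=
  ofArcs [(1, 0), (2, 0), (3, 1), (4, 1), (4, 2), (5, 2), (5, 3)]

def J7 : Digraph (Fin 6) :=
  ofArcs [(1, 0), (4, 0), (2, 1), (5, 1), (3, 2), (4, 2), (5, 3)]

def J8 : Digraph (Fin 6) :=
  ofArcs [(1, 0), (3, 0), (4, 1), (5, 1), (0, 2), (4, 2), (5, 3)]

def J9 : Digraph (Fin 6) :=
  ofArcs [(1, 0), (4, 0), (3, 1), (5, 1), (4, 2), (5, 2), (0, 3)]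

def J10 : Digraph (Fin 7) :=
  ofArcs [(1, 0), (4, 0), (2, 1), (5, 1), (4, 2), (6, 2), (5, 3), (6, 3)]

def J11 : Digraph (Fin 7) :=
  ofArcs [(1, 0), (2, 0), (4, 1), (5, 1), (4, 2), (6, 2), (5, 3), (6, 3)]

def J12 : Digraph (Fin 7) :=
  ofArcs [(1, 0), (4, 0), (5, 1), (6, 1), (3, 2), (5, 2), (4, 3), (6, 3)]

def J13 : Digraph (Fin 9) :=
  ofArcs [(3, 0), (6, 0), (4, 1), (7, 1), (5, 2), (8, 2), (1, 3), (8, 3), (2, 4), (6, 4), (0, 5), (7, 5)]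

def J14 : Digraph (Fin 9) :=
  ofArcs [(3, 0), (4, 0), (5, 1), (6, 1), (7, 2), (8, 2), (1, 3), (7, 3), (2, 4), (6, 4), (0, 5), (8, 5)]

def J15 : Digraph (Fin 9) :=
  ofArcs [(3, 0), (4, 0), (5, 1), (6, 1), (7, 2), (8, 2), (1, 3), (2, 3), (6, 4), (7, 4), (0, 5), (8, 5)]

end InRegularCode

/-! Enlarging a code keeps it a code, so a code exists if and only if all of `V` is one, that is, if
`N⁻[X] ≠ N⁻[Y]` for all distinct `X`, `Y` with one to three elements.

Necessity: each forbidden digraph contains two distinct small sets whose closed in-neighbourhoods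
must agree. Two in-arcs of `v` inside a copy are all the in-arcs of `v` in `D`, since in-degrees are
2, so the equality seen in the copy holds in `D` (`IsAbsorbed.closedInNbrs_subset`). In a digon or a
transitive triangle some `N⁻[v]` is covered by `N⁻[a] ∪ N⁻[b]`, and then `{a, b}` and `{v, a, b}`
are not separated.

Sufficiency: let `N⁻[X] = N⁻[Y]` with `X ≠ Y`. Without digons and transitive triangles, covering
`N⁻[y]` by two other closed in-neighbourhoods forces `J1` (`containsCopy_J1_of_subset_pair`); this
settles the case that `X` or `Y` has at most two elements. If both have three, then `N⁻[X]` has at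
most nine vertices, and `Y` and all its in-neighbours lie among them. This leaves finitely many
configurations. `checkTriples` enumerates them up to symmetry and finds a forbidden digraph in each.
The rest of the argument shows that the configuration read off from `D` (`Represents`) is one of
those enumerated. -/

namespace InRegularCode

/-! ### The exhaustive search -/

/-- A list of records `(v, p, q)`, each stating that the in-neighbours of `v` are `p` and `q`. -/
abbrev InPairs := List (ℕ × ℕ × ℕ)

/-- `g` holds for all numbers below `n`. -/
def allBelow (n : ℕ) (g : ℕ → Bool) : Bool := Nat.rec true (fun k ih => g k && ih) n

/-- `g` holds for some record of `s`. -/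
def anyRecord (s : InPairs) (g : ℕ → ℕ → ℕ → Bool) : Bool :=
  List.rec false (fun r _ ih => Prod.rec (fun v pq => Prod.rec (fun p q => g v p q) pq) r || ih) s

/-- `k` holds for some record of `s` whose in-neighbours are listed in one of the two orders. -/
def anyVertex (s : InPairs) (k : ℕ → ℕ → ℕ → Bool) : Bool :=
  anyRecord s fun v p q => k v p q || k v q p

/-- `k` holds for the in-neighbours of `v` recorded in `s`, in one of the two orders. -/
def anyOrder (s : InPairs) (v : ℕ) (k : ℕ → ℕ → Bool) : Bool :=
  anyRecord s fun w p q => Nat.beq w v && (k p q || k q p)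

/-- `a` is one of `p`, `q`. -/
def isOneOf (a p q : ℕ) : Bool := Nat.beq a p || Nat.beq a q

/-- `a` is one of `p`, `q`, `r`. -/
def isOneOfThree (a p q r : ℕ) : Bool := Nat.beq a p || (Nat.beq a q || Nat.beq a r)

/-- The arc `u → v` is recorded in `s`. -/
def isArc (s : InPairs) (u v : ℕ) : Bool := anyRecord s fun w p q => Nat.beq w v && isOneOf u p q

/-- The entries of `l` are distinct. -/
def allDistinct : List ℕ → Bool
  | [] => true
  | a :: l => (l.all fun b => !Nat.beq a b) && allDistinct l

/-- Sending each `i` to the `i`-th entry of `L` embeds the digraph with arcs `l` into `s`. -/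
def isCopy (s : InPairs) {n : ℕ} (l : List (Fin n × Fin n)) (L : List ℕ) : Bool :=
  Nat.beq L.length n && (allDistinct L && l.all fun e => isArc s (L.getD e.1 0) (L.getD e.2 0))

/-- Giving `y` the in-neighbours `p` and `q` creates a loop, a digon or a transitive triangle. -/
def clashes (s : InPairs) (y p q : ℕ) : Bool :=
  isOneOf y p q || anyRecord s fun v a b =>
    (Nat.beq v p && (isOneOf y a b || isOneOf q a b)) ||
    (Nat.beq v q && (isOneOf y a b || isOneOf p a b)) ||
    (Nat.beq a y && (isOneOf v p q || isOneOf b p q)) ||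
    (Nat.beq b y && (isOneOf v p q || isOneOf a p q))

/-- `k p q` holds for all labels `p < q < n` that can be the in-neighbours of `v`. -/
def forPairs (n : ℕ) (s : InPairs) (v : ℕ) (k : ℕ → ℕ → Bool) : Bool :=
  allBelow n fun q => allBelow q fun p => clashes s v p q || k p q

/-- `k` holds for all possible pairs of in-neighbours of `v`, where the labels from `n` on are
given to vertices that have no label yet. The first argument of `k` is the new number of labels. -/
def forPairsNew (n : ℕ) (s : InPairs) (v : ℕ) (k : ℕ → ℕ → ℕ → Bool) : Bool :=
  forPairs n s v (k n) && ((allBelow n fun p => clashes s v p n || k (n + 1) p n) &&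
    -- Two fresh labels occur in no record, so they cannot clash.
    k (n + 2) n (n + 1))

/-- Pass `l.filter g` on to `k`, written such that `k` receives an evaluated list. -/
def filterThen (g : ℕ → Bool) (l : List ℕ) (k : List ℕ → Bool) : Bool :=
  List.rec (fun k => k []) (fun a _ ih k => bif g a then ih fun r => k (a :: r) else ih k) l k

/-- `k` holds for all labels `p < q < n` that can be the in-neighbours of `y` and leave at most `r`
of the labels in `miss`. -/
def forCovering (n r y : ℕ) (k : InPairs → List ℕ → Bool) (s : InPairs) (miss : List ℕ) : Bool :=
  -- Each in-neighbour removes at most one missing label: the bounds `r + 2`, `r + 1`, `r` prune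
  -- before, between and after the two choices.
  !Nat.ble miss.length (r + 2) || allBelow n fun q => Nat.beq q y ||
    filterThen (fun l => !Nat.beq l q) miss fun miss => !Nat.ble miss.length (r + 1) ||
      allBelow q fun p => filterThen (fun l => !Nat.beq l p) miss fun miss =>
        !Nat.ble miss.length r || (clashes s y p q || k ((y, p, q) :: s) miss)

/-! ### Searching for the forbidden digraphs -/

/-- In this and the following searches the early tests only cut down the candidates. The final
`isCopy` verifies the whole pattern, so soundness rests on it alone. -/
def findJ1 (s : InPairs) : Bool :=
  anyVertex s fun v₀ v₃ v₄ => anyRecord s fun v₁ p q =>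
    isOneOf v₃ p q && (isOneOf v₄ p q && (!Nat.beq v₀ v₁ && anyRecord s fun v₂ a b =>
      isOneOf v₀ a b && isCopy s (n := 5) [(3, 0), (4, 0), (3, 1), (4, 1), (0, 2)]
        [v₀, v₁, v₂, v₃, v₄]))

def findJ2 (s : InPairs) : Bool :=
  anyVertex s fun v₀ v₁ v₂ => anyOrder s v₁ fun v₃ v₄ => isArc s v₄ v₂ && (isArc s v₀ v₃ &&
    isCopy s (n := 5) [(1, 0), (2, 0), (3, 1), (4, 1), (4, 2), (0, 3)] [v₀, v₁, v₂, v₃, v₄])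

def findJ3 (s : InPairs) : Bool :=
  anyVertex s fun v₀ v₁ v₄ => anyOrder s v₁ fun v₂ v₃ => isArc s v₀ v₂ && (isArc s v₄ v₃ &&
    isCopy s (n := 5) [(1, 0), (4, 0), (2, 1), (3, 1), (0, 2), (4, 3)] [v₀, v₁, v₂, v₃, v₄])

def findJ4 (s : InPairs) : Bool :=
  anyVertex s fun v₀ v₂ v₄ => anyVertex s fun v₁ v₃ v₄' => Nat.beq v₄ v₄' && (isArc s v₁ v₂ &&
    (isArc s v₀ v₃ &&
    isCopy s (n := 5) [(2, 0), (4, 0), (3, 1), (4, 1), (1, 2), (0, 3)] [v₀, v₁, v₂, v₃, v₄]))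

def findJ5 (s : InPairs) : Bool :=
  anyVertex s fun v₀ v₁ v₄ => anyOrder s v₁ fun v₃ v₅ => anyRecord s fun v₂ a b =>
    isOneOf v₄ a b && (isOneOf v₅ a b && (isArc s v₂ v₃ &&
    isCopy s (n := 6) [(1, 0), (4, 0), (3, 1), (5, 1), (4, 2), (5, 2), (2, 3)]
      [v₀, v₁, v₂, v₃, v₄, v₅]))

def findJ6 (s : InPairs) : Bool :=
  anyVertex s fun v₀ v₁ v₂ => anyOrder s v₁ fun v₃ v₄ => anyOrder s v₂ fun v₄' v₅ =>
    Nat.beq v₄ v₄' && (isArc s v₅ v₃ &&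
    isCopy s (n := 6) [(1, 0), (2, 0), (3, 1), (4, 1), (4, 2), (5, 2), (5, 3)]
      [v₀, v₁, v₂, v₃, v₄, v₅])

def findJ7 (s : InPairs) : Bool :=
  anyVertex s fun v₀ v₁ v₄ => anyOrder s v₁ fun v₂ v₅ => anyOrder s v₂ fun v₄' v₃ =>
    Nat.beq v₄ v₄' && (isArc s v₅ v₃ &&
    isCopy s (n := 6) [(1, 0), (4, 0), (2, 1), (5, 1), (3, 2), (4, 2), (5, 3)]
      [v₀, v₁, v₂, v₃, v₄, v₅])

def findJ8 (s : InPairs) : Bool :=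
  anyVertex s fun v₀ v₁ v₃ => anyOrder s v₁ fun v₄ v₅ => isArc s v₅ v₃ &&
    anyRecord s fun v₂ a b => isOneOf v₀ a b && (isOneOf v₄ a b &&
    isCopy s (n := 6) [(1, 0), (3, 0), (4, 1), (5, 1), (0, 2), (4, 2), (5, 3)]
      [v₀, v₁, v₂, v₃, v₄, v₅])

def findJ9 (s : InPairs) : Bool :=
  anyVertex s fun v₀ v₁ v₄ => anyOrder s v₁ fun v₃ v₅ => isArc s v₀ v₃ &&
    anyRecord s fun v₂ a b => isOneOf v₅ a b && (isOneOf v₄ a b &&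
    isCopy s (n := 6) [(1, 0), (4, 0), (3, 1), (5, 1), (4, 2), (5, 2), (0, 3)]
      [v₀, v₁, v₂, v₃, v₄, v₅])

def findJ10 (s : InPairs) : Bool :=
  anyVertex s fun v₀ v₁ v₄ => anyOrder s v₁ fun v₂ v₅ => anyOrder s v₂ fun v₄' v₆ =>
    Nat.beq v₄ v₄' && anyRecord s fun v₃ a b => isOneOf v₅ a b && (isOneOf v₆ a b &&
    isCopy s (n := 7) [(1, 0), (4, 0), (2, 1), (5, 1), (4, 2), (6, 2), (5, 3), (6, 3)]
      [v₀, v₁, v₂, v₃, v₄, v₅, v₆])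

def findJ11 (s : InPairs) : Bool :=
  anyVertex s fun v₀ v₁ v₂ => anyOrder s v₁ fun v₄ v₅ => anyOrder s v₂ fun v₄' v₆ =>
    Nat.beq v₄ v₄' && anyRecord s fun v₃ a b => isOneOf v₅ a b && (isOneOf v₆ a b &&
    isCopy s (n := 7) [(1, 0), (2, 0), (4, 1), (5, 1), (4, 2), (6, 2), (5, 3), (6, 3)]
      [v₀, v₁, v₂, v₃, v₄, v₅, v₆])

def findJ12 (s : InPairs) : Bool :=
  anyVertex s fun v₀ v₁ v₄ => anyOrder s v₁ fun v₅ v₆ => anyRecord s fun v₃ a b =>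
    isOneOf v₄ a b && (isOneOf v₆ a b && anyRecord s fun v₂ a b =>
    isOneOf v₃ a b && (isOneOf v₅ a b &&
    isCopy s (n := 7) [(1, 0), (4, 0), (5, 1), (6, 1), (3, 2), (5, 2), (4, 3), (6, 3)]
      [v₀, v₁, v₂, v₃, v₄, v₅, v₆]))

def findJ13 (s : InPairs) : Bool :=
  anyVertex s fun v₀ v₃ v₆ => anyOrder s v₃ fun v₁ v₈ => anyOrder s v₁ fun v₄ v₇ =>
    anyOrder s v₄ fun v₂ v₆' => Nat.beq v₆ v₆' && anyOrder s v₂ fun v₅ v₈' => Nat.beq v₈ v₈' &&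
    (isArc s v₀ v₅ && (isArc s v₇ v₅ &&
    isCopy s (n := 9) [(3, 0), (6, 0), (4, 1), (7, 1), (5, 2), (8, 2), (1, 3), (8, 3), (2, 4),
      (6, 4), (0, 5), (7, 5)] [v₀, v₁, v₂, v₃, v₄, v₅, v₆, v₇, v₈]))

def findJ14 (s : InPairs) : Bool :=
  anyVertex s fun v₀ v₃ v₄ => anyOrder s v₃ fun v₁ v₇ => anyOrder s v₁ fun v₅ v₆ =>
    anyOrder s v₅ fun v₀' v₈ => Nat.beq v₀ v₀' && anyOrder s v₄ fun v₂ v₆' => Nat.beq v₆ v₆' &&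
    (isArc s v₇ v₂ && (isArc s v₈ v₂ &&
    isCopy s (n := 9) [(3, 0), (4, 0), (5, 1), (6, 1), (7, 2), (8, 2), (1, 3), (7, 3), (2, 4),
      (6, 4), (0, 5), (8, 5)] [v₀, v₁, v₂, v₃, v₄, v₅, v₆, v₇, v₈]))

def findJ15 (s : InPairs) : Bool :=
  anyVertex s fun v₀ v₃ v₄ => anyOrder s v₃ fun v₁ v₂ => anyOrder s v₁ fun v₅ v₆ =>
    anyOrder s v₅ fun v₀' v₈ => Nat.beq v₀ v₀' && anyOrder s v₄ fun v₇ v₆' => Nat.beq v₆ v₆' &&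
    (isArc s v₇ v₂ && (isArc s v₈ v₂ &&
    isCopy s (n := 9) [(3, 0), (4, 0), (5, 1), (6, 1), (7, 2), (8, 2), (1, 3), (2, 3), (6, 4),
      (7, 4), (0, 5), (8, 5)] [v₀, v₁, v₂, v₃, v₄, v₅, v₆, v₇, v₈]))

/-- Search for a copy of one of the fifteen forbidden digraphs in a configuration on `n` labels. -/
def findForbidden (n : ℕ) (s : InPairs) : Bool :=
  -- The patterns on nine vertices need nine distinct labels, and with nine labels they turn out to
  -- suffice.
  bif Nat.beq n 9 then findJ14 s || (findJ15 s || findJ13 s)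
  else findJ1 s || (findJ2 s || (findJ4 s || (findJ3 s || (findJ8 s || (findJ5 s || (findJ6 s ||
    (findJ9 s || (findJ7 s || (findJ11 s || (findJ10 s || findJ12 s))))))))))

/-! ### Enumerating pairs of triples -/

/-- A numerical invariant used to order the vertices `0`, `1`, `2`: here `p` and `q` are the
in-neighbours of `x`. -/
def weight (x p q y₁ y₂ y₃ : ℕ) : ℕ :=
  (bif isOneOfThree x y₁ y₂ y₃ then 9 else 0) +
    (((bif isOneOfThree p 0 1 2 then 3 else 0) + (bif isOneOfThree p y₁ y₂ y₃ then 1 else 0)) +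
    ((bif isOneOfThree q 0 1 2 then 3 else 0) + (bif isOneOfThree q y₁ y₂ y₃ then 1 else 0)))

/-- The label `l` is neither among `y₁`, `y₂`, `y₃` nor recorded as an in-neighbour of one of
them. -/
def isUncovered (s : InPairs) (y₁ y₂ y₃ l : ℕ) : Bool :=
  !isOneOfThree l y₁ y₂ y₃ && !anyRecord s fun v p q => isOneOfThree v y₁ y₂ y₃ && isOneOf l p q

/-- The search for a triple `y₁ < y₂ < y₃` with the same closed in-neighbourhood as `0, 1, 2`,
when the in-neighbours of the latter are given. -/
def chooseTriple (n p₀ q₀ p₁ q₁ p₂ q₂ : ℕ) : Bool :=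
  allBelow n fun y₃ => allBelow y₃ fun y₂ => allBelow y₂ fun y₁ =>
    -- For `y₁ < y₂ < y₃ = 2` the second triple equals the first. The two weight tests break the
    -- symmetry between `0`, `1`, `2`.
    Nat.beq y₃ 2 ||
    (!Nat.ble (weight 0 p₀ q₀ y₁ y₂ y₃) (weight 1 p₁ q₁ y₁ y₂ y₃) ||
    (!Nat.ble (weight 1 p₁ q₁ y₁ y₂ y₃) (weight 2 p₂ q₂ y₁ y₂ y₃) ||
    filterThen (isUncovered [(2, p₂, q₂), (1, p₁, q₁), (0, p₀, q₀)] y₁ y₂ y₃) (List.range n)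
    -- Labels below 3 already have records, and `y₃ ≥ 3` always. The bounds 4, 2, 0 are twice the
    -- number of vertices of the second triple still to be treated.
    ((bif Nat.ble 3 y₁ then forCovering n 4 y₁ (forCovering n 2 y₂ (forCovering n 0 y₃
      fun s _ => findForbidden n s))
    else bif Nat.ble 3 y₂ then forCovering n 2 y₂ (forCovering n 0 y₃ fun s _ => findForbidden n s)
    else forCovering n 0 y₃ fun s _ => findForbidden n s)
    [(2, p₂, q₂), (1, p₁, q₁), (0, p₀, q₀)])))

/-- The search for two triples with the same closed in-neighbourhood, the first of which consists
of the labels `0`, `1`, `2`. -/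
def checkTriples : Bool :=
  forPairsNew 3 [] 0 fun n p₀ q₀ =>
  forPairsNew n [(0, p₀, q₀)] 1 fun n p₁ q₁ =>
  forPairsNew n [(1, p₁, q₁), (0, p₀, q₀)] 2 fun n p₂ q₂ =>
  chooseTriple n p₀ q₀ p₁ q₁ p₂ q₂

-- This evaluation is why the search is Boolean and built on recursors, `Nat.beq` and `Nat.ble`: the
-- kernel computes the latter two directly on numerals.
set_option maxRecDepth 100000 in
theorem checkTriples_eq_true : checkTriples = true := by decide +kernel

/-! ### Meaning of the Boolean combinators -/

theorem allBelow_iff {n : ℕ} {g : ℕ → Bool} : allBelow n g = true ↔ ∀ k < n, g k = true := by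
  induction n with
  | zero => simp [allBelow]
  | succ n ih =>
    have : allBelow (n + 1) g = (g n && allBelow n g) := rfl
    rw [this, Bool.and_eq_true, ih]
    constructor
    · rintro ⟨h₁, h₂⟩ k hk
      rcases Nat.lt_succ_iff_lt_or_eq.1 hk with h | rfl
      exacts [h₂ k h, h₁]
    · exact fun h => ⟨h n n.lt_succ_self, fun k hk => h k (hk.trans n.lt_succ_self)⟩

theorem anyRecord_iff {s : InPairs} {g : ℕ → ℕ → ℕ → Bool} :
    anyRecord s g = true ↔ ∃ v p q, (v, p, q) ∈ s ∧ g v p q = true := by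
  induction s with
  | nil => simp [anyRecord]
  | cons r s ih =>
    obtain ⟨v, p, q⟩ := r
    have : anyRecord ((v, p, q) :: s) g = (g v p q || anyRecord s g) := rfl
    rw [this, Bool.or_eq_true, ih]
    constructor
    · rintro (h | ⟨v', p', q', h, h'⟩)
      · exact ⟨v, p, q, List.mem_cons_self, h⟩
      · exact ⟨v', p', q', List.mem_cons_of_mem _ h, h'⟩
    · rintro ⟨v', p', q', h, h'⟩
      rcases List.mem_cons.1 h with h | h
      · cases h; exact Or.inl h'
      · exact Or.inr ⟨v', p', q', h, h'⟩

theorem exists_of_anyVertex {s : InPairs} {k : ℕ → ℕ → ℕ → Bool} (h : anyVertex s k = true) :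
    ∃ v p q, k v p q = true := by
  obtain ⟨v, p, q, -, h⟩ := anyRecord_iff.1 h
  rcases Bool.or_eq_true _ _ ▸ h with h | h
  exacts [⟨_, _, _, h⟩, ⟨_, _, _, h⟩]

theorem exists_of_anyOrder {s : InPairs} {v : ℕ} {k : ℕ → ℕ → Bool} (h : anyOrder s v k = true) :
    ∃ p q, k p q = true := by
  obtain ⟨v, p, q, -, h⟩ := anyRecord_iff.1 h
  rw [Bool.and_eq_true, Bool.or_eq_true] at h
  rcases h.2 with h | h
  exacts [⟨_, _, h⟩, ⟨_, _, h⟩]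

theorem isOneOf_iff {a p q : ℕ} : isOneOf a p q = true ↔ a = p ∨ a = q := by
  simp [isOneOf]

theorem isOneOfThree_iff {a p q r : ℕ} :
    isOneOfThree a p q r = true ↔ a = p ∨ a = q ∨ a = r := by
  simp [isOneOfThree]

theorem isArc_iff {s : InPairs} {u v : ℕ} :
    isArc s u v = true ↔ ∃ p q, (v, p, q) ∈ s ∧ (u = p ∨ u = q) := by
  simp only [isArc, anyRecord_iff, Bool.and_eq_true, isOneOf_iff, Nat.beq_eq]
  constructor
  · rintro ⟨_, p, q, h, rfl, h'⟩
    exact ⟨p, q, h, h'⟩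
  · rintro ⟨p, q, h, h'⟩
    exact ⟨_, p, q, h, rfl, h'⟩

theorem allDistinct_iff {l : List ℕ} : allDistinct l = true ↔ l.Nodup := by
  induction l with
  | nil => simp [allDistinct]
  | cons a l ih =>
    simp only [allDistinct, Bool.and_eq_true, ih, List.all_eq_true, List.nodup_cons]
    refine and_congr_left fun _ => ⟨fun h ha => by simpa using h a ha, fun h b hb => ?_⟩
    rw [Bool.not_eq_true', ← Bool.not_eq_true, Nat.beq_eq]
    exact fun e => h (e ▸ hb)

theorem filterThen_eq (g : ℕ → Bool) (l : List ℕ) (k : List ℕ → Bool) :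
    filterThen g l k = k (l.filter g) := by
  induction l generalizing k with
  | nil => rfl
  | cons a l ih =>
    have : filterThen g (a :: l) k =
      bif g a then filterThen g l (fun r => k (a :: r)) else filterThen g l k := rfl
    rw [this, ih, ih, List.filter_cons]
    cases g a <;> rfl

/-! ### Labelled configurations in a digraph -/

/-- The vertices `f 0, …, f (n - 1)` of `D` are distinct, and `s` records in-neighbourhoods of
some of them. -/
structure Represents {V : Type*} (D : Digraph V) (f : ℕ → V) (n : ℕ) (s : InPairs) : Prop where
  inj : ∀ i < n, ∀ j < n, f i = f j → i = j
  record : ∀ v p q, (v, p, q) ∈ s → v < n ∧ p < n ∧ q < n ∧ D.inNbr (f v) = {f p, f q}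

namespace Represents

variable {V : Type*} {D : Digraph V} {f : ℕ → V} {n : ℕ} {s : InPairs}

theorem adj_left (h : Represents D f n s) {v p q : ℕ} (hs : (v, p, q) ∈ s) : D.Adj (f p) (f v) := by
  have : f p ∈ D.inNbr (f v) := by rw [(h.record v p q hs).2.2.2]; exact Or.inl rfl
  exact this

theorem adj_right (h : Represents D f n s) {v p q : ℕ} (hs : (v, p, q) ∈ s) :
    D.Adj (f q) (f v) := by
  have : f q ∈ D.inNbr (f v) := by rw [(h.record v p q hs).2.2.2]; exact Or.inr rfl
  exact this

theorem adj_of_isArc (h : Represents D f n s) {u v : ℕ} (ha : isArc s u v = true) :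
    u < n ∧ v < n ∧ D.Adj (f u) (f v) := by
  obtain ⟨p, q, hs, rfl | rfl⟩ := isArc_iff.1 ha
  · exact ⟨(h.record _ _ _ hs).2.1, (h.record _ _ _ hs).1, h.adj_left hs⟩
  · exact ⟨(h.record _ _ _ hs).2.2.1, (h.record _ _ _ hs).1, h.adj_right hs⟩

/-- A copy found in the records is a copy in the digraph, provided that every vertex of the
pattern is on an arc. -/
theorem containsCopy (h : Represents D f n s) {m : ℕ} {l : List (Fin m × Fin m)} {L : List ℕ}
    (hL : isCopy s l L = true) (hl : ∀ i : Fin m, ∃ e ∈ l, e.1 = i ∨ e.2 = i) :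
    D.ContainsCopy (ofArcs l) := by
  simp only [isCopy, Bool.and_eq_true, allDistinct_iff, List.all_eq_true, Nat.beq_eq] at hL
  obtain ⟨hlen, hnd, harc⟩ := hL
  refine ⟨fun i => f (L.getD i 0), fun i j hij => ?_, fun a b hab => ?_⟩
  -- `f` is injective only on labels below `n`, and being an end of a recorded arc guarantees this
  -- bound. As `L` has length `m`, the default value 0 is never used.
  · have hlt : ∀ i : Fin m, L.getD i 0 < n := by
      intro i
      obtain ⟨e, he, rfl | rfl⟩ := hl i
      exacts [(h.adj_of_isArc (harc e he)).1, (h.adj_of_isArc (harc e he)).2.1]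
    have := h.inj _ (hlt i) _ (hlt j) hij
    have hi : (i : ℕ) < L.length := by have := i.2; omega
    have hj : (j : ℕ) < L.length := by have := j.2; omega
    rw [List.getD_eq_getElem _ _ hi, List.getD_eq_getElem _ _ hj] at this
    exact Fin.ext ((hnd.getElem_inj_iff).1 this)
  · exact (h.adj_of_isArc (harc _ hab)).2.2

end Represents

/-- One of the fifteen forbidden digraphs occurs in `D`. -/
def ContainsForbidden {V : Type*} (D : Digraph V) : Prop :=
  D.ContainsCopy J1 ∨ D.ContainsCopy J2 ∨ D.ContainsCopy J3 ∨ D.ContainsCopy J4 ∨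
  D.ContainsCopy J5 ∨ D.ContainsCopy J6 ∨ D.ContainsCopy J7 ∨ D.ContainsCopy J8 ∨
  D.ContainsCopy J9 ∨ D.ContainsCopy J10 ∨ D.ContainsCopy J11 ∨ D.ContainsCopy J12 ∨
  D.ContainsCopy J13 ∨ D.ContainsCopy J14 ∨ D.ContainsCopy J15

/-! ### Soundness of the pattern searches -/

section Find

variable {V : Type*} {D : Digraph V} {f : ℕ → V} {n : ℕ} {s : InPairs}

theorem containsCopy_of_findJ1 (h : Represents D f n s) (hs : findJ1 s = true) :
    D.ContainsCopy J1 := by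
  obtain ⟨v₀, v₃, v₄, hs⟩ := exists_of_anyVertex hs
  obtain ⟨v₁, _, _, -, hs⟩ := anyRecord_iff.1 hs
  simp only [Bool.and_eq_true] at hs
  obtain ⟨v₂, _, _, -, hs⟩ := anyRecord_iff.1 hs.2.2.2
  exact h.containsCopy (Bool.and_eq_true _ _ ▸ hs).2 (by decide)

theorem containsCopy_of_findJ2 (h : Represents D f n s) (hs : findJ2 s = true) :
    D.ContainsCopy J2 := by
  obtain ⟨v₀, v₁, v₂, hs⟩ := exists_of_anyVertex hs
  obtain ⟨v₃, v₄, hs⟩ := exists_of_anyOrder hs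
  simp only [Bool.and_eq_true] at hs
  exact h.containsCopy hs.2.2 (by decide)

theorem containsCopy_of_findJ3 (h : Represents D f n s) (hs : findJ3 s = true) :
    D.ContainsCopy J3 := by
  obtain ⟨v₀, v₁, v₄, hs⟩ := exists_of_anyVertex hs
  obtain ⟨v₂, v₃, hs⟩ := exists_of_anyOrder hs
  simp only [Bool.and_eq_true] at hs
  exact h.containsCopy hs.2.2 (by decide)

theorem containsCopy_of_findJ4 (h : Represents D f n s) (hs : findJ4 s = true) :
    D.ContainsCopy J4 := by
  obtain ⟨v₀, v₂, v₄, hs⟩ := exists_of_anyVertex hs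
  obtain ⟨v₁, v₃, _, hs⟩ := exists_of_anyVertex hs
  simp only [Bool.and_eq_true] at hs
  exact h.containsCopy hs.2.2.2 (by decide)

theorem containsCopy_of_findJ5 (h : Represents D f n s) (hs : findJ5 s = true) :
    D.ContainsCopy J5 := by
  obtain ⟨v₀, v₁, v₄, hs⟩ := exists_of_anyVertex hs
  obtain ⟨v₃, v₅, hs⟩ := exists_of_anyOrder hs
  obtain ⟨v₂, _, _, -, hs⟩ := anyRecord_iff.1 hs
  simp only [Bool.and_eq_true] at hs
  exact h.containsCopy hs.2.2.2 (by decide)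

theorem containsCopy_of_findJ6 (h : Represents D f n s) (hs : findJ6 s = true) :
    D.ContainsCopy J6 := by
  obtain ⟨v₀, v₁, v₂, hs⟩ := exists_of_anyVertex hs
  obtain ⟨v₃, v₄, hs⟩ := exists_of_anyOrder hs
  obtain ⟨_, v₅, hs⟩ := exists_of_anyOrder hs
  simp only [Bool.and_eq_true] at hs
  exact h.containsCopy hs.2.2 (by decide)

theorem containsCopy_of_findJ7 (h : Represents D f n s) (hs : findJ7 s = true) :
    D.ContainsCopy J7 := by
  obtain ⟨v₀, v₁, v₄, hs⟩ := exists_of_anyVertex hs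
  obtain ⟨v₂, v₅, hs⟩ := exists_of_anyOrder hs
  obtain ⟨_, v₃, hs⟩ := exists_of_anyOrder hs
  simp only [Bool.and_eq_true] at hs
  exact h.containsCopy hs.2.2 (by decide)

theorem containsCopy_of_findJ8 (h : Represents D f n s) (hs : findJ8 s = true) :
    D.ContainsCopy J8 := by
  obtain ⟨v₀, v₁, v₃, hs⟩ := exists_of_anyVertex hs
  obtain ⟨v₄, v₅, hs⟩ := exists_of_anyOrder hs
  obtain ⟨v₂, _, _, -, hs⟩ := anyRecord_iff.1 (Bool.and_eq_true _ _ ▸ hs).2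
  simp only [Bool.and_eq_true] at hs
  exact h.containsCopy hs.2.2 (by decide)

theorem containsCopy_of_findJ9 (h : Represents D f n s) (hs : findJ9 s = true) :
    D.ContainsCopy J9 := by
  obtain ⟨v₀, v₁, v₄, hs⟩ := exists_of_anyVertex hs
  obtain ⟨v₃, v₅, hs⟩ := exists_of_anyOrder hs
  obtain ⟨v₂, _, _, -, hs⟩ := anyRecord_iff.1 (Bool.and_eq_true _ _ ▸ hs).2
  simp only [Bool.and_eq_true] at hs
  exact h.containsCopy hs.2.2 (by decide)

theorem containsCopy_of_findJ10 (h : Represents D f n s) (hs : findJ10 s = true) :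
    D.ContainsCopy J10 := by
  obtain ⟨v₀, v₁, v₄, hs⟩ := exists_of_anyVertex hs
  obtain ⟨v₂, v₅, hs⟩ := exists_of_anyOrder hs
  obtain ⟨_, v₆, hs⟩ := exists_of_anyOrder hs
  obtain ⟨v₃, _, _, -, hs⟩ := anyRecord_iff.1 (Bool.and_eq_true _ _ ▸ hs).2
  simp only [Bool.and_eq_true] at hs
  exact h.containsCopy hs.2.2 (by decide)

theorem containsCopy_of_findJ11 (h : Represents D f n s) (hs : findJ11 s = true) :
    D.ContainsCopy J11 := by
  obtain ⟨v₀, v₁, v₂, hs⟩ := exists_of_anyVertex hs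
  obtain ⟨v₄, v₅, hs⟩ := exists_of_anyOrder hs
  obtain ⟨_, v₆, hs⟩ := exists_of_anyOrder hs
  obtain ⟨v₃, _, _, -, hs⟩ := anyRecord_iff.1 (Bool.and_eq_true _ _ ▸ hs).2
  simp only [Bool.and_eq_true] at hs
  exact h.containsCopy hs.2.2 (by decide)

theorem containsCopy_of_findJ12 (h : Represents D f n s) (hs : findJ12 s = true) :
    D.ContainsCopy J12 := by
  obtain ⟨v₀, v₁, v₄, hs⟩ := exists_of_anyVertex hs
  obtain ⟨v₅, v₆, hs⟩ := exists_of_anyOrder hs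
  obtain ⟨v₃, _, _, -, hs⟩ := anyRecord_iff.1 hs
  simp only [Bool.and_eq_true] at hs
  obtain ⟨v₂, _, _, -, hs⟩ := anyRecord_iff.1 hs.2.2
  simp only [Bool.and_eq_true] at hs
  exact h.containsCopy hs.2.2 (by decide)

theorem containsCopy_of_findJ13 (h : Represents D f n s) (hs : findJ13 s = true) :
    D.ContainsCopy J13 := by
  obtain ⟨v₀, v₃, v₆, hs⟩ := exists_of_anyVertex hs
  obtain ⟨v₁, v₈, hs⟩ := exists_of_anyOrder hs
  obtain ⟨v₄, v₇, hs⟩ := exists_of_anyOrder hs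
  obtain ⟨v₂, _, hs⟩ := exists_of_anyOrder hs
  obtain ⟨v₅, _, hs⟩ := exists_of_anyOrder (Bool.and_eq_true _ _ ▸ hs).2
  simp only [Bool.and_eq_true] at hs
  exact h.containsCopy hs.2.2.2 (by decide)

theorem containsCopy_of_findJ14 (h : Represents D f n s) (hs : findJ14 s = true) :
    D.ContainsCopy J14 := by
  obtain ⟨v₀, v₃, v₄, hs⟩ := exists_of_anyVertex hs
  obtain ⟨v₁, v₇, hs⟩ := exists_of_anyOrder hs
  obtain ⟨v₅, v₆, hs⟩ := exists_of_anyOrder hs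
  obtain ⟨_, v₈, hs⟩ := exists_of_anyOrder hs
  obtain ⟨v₂, _, hs⟩ := exists_of_anyOrder (Bool.and_eq_true _ _ ▸ hs).2
  simp only [Bool.and_eq_true] at hs
  exact h.containsCopy hs.2.2.2 (by decide)

theorem containsCopy_of_findJ15 (h : Represents D f n s) (hs : findJ15 s = true) :
    D.ContainsCopy J15 := by
  obtain ⟨v₀, v₃, v₄, hs⟩ := exists_of_anyVertex hs
  obtain ⟨v₁, v₂, hs⟩ := exists_of_anyOrder hs
  obtain ⟨v₅, v₆, hs⟩ := exists_of_anyOrder hs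
  obtain ⟨_, v₈, hs⟩ := exists_of_anyOrder hs
  obtain ⟨v₇, _, hs⟩ := exists_of_anyOrder (Bool.and_eq_true _ _ ▸ hs).2
  simp only [Bool.and_eq_true] at hs
  exact h.containsCopy hs.2.2.2 (by decide)

theorem containsForbidden_of_findForbidden {m : ℕ} (h : Represents D f n s)
    (hs : findForbidden m s = true) : ContainsForbidden D := by
  unfold findForbidden at hs
  unfold ContainsForbidden
  cases hm : Nat.beq m 9 <;>
    simp only [hm, cond_true, cond_false, Bool.or_eq_true] at hs
  · rcases hs with hs | hs | hs | hs | hs | hs | hs | hs | hs | hs | hs | hs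
    · simp [containsCopy_of_findJ1 h hs]
    · simp [containsCopy_of_findJ2 h hs]
    · simp [containsCopy_of_findJ4 h hs]
    · simp [containsCopy_of_findJ3 h hs]
    · simp [containsCopy_of_findJ8 h hs]
    · simp [containsCopy_of_findJ5 h hs]
    · simp [containsCopy_of_findJ6 h hs]
    · simp [containsCopy_of_findJ9 h hs]
    · simp [containsCopy_of_findJ7 h hs]
    · simp [containsCopy_of_findJ11 h hs]
    · simp [containsCopy_of_findJ10 h hs]
    · simp [containsCopy_of_findJ12 h hs]
  · rcases hs with hs | hs | hs
    · simp [containsCopy_of_findJ14 h hs]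
    · simp [containsCopy_of_findJ15 h hs]
    · simp [containsCopy_of_findJ13 h hs]

end Find

/-! ### The enumeration reaches the actual in-neighbourhoods -/

/-- `D` has no loops, no digons and no transitive triangles. -/
structure IsTame {V : Type*} (D : Digraph V) : Prop where
  loop : ∀ v, ¬ D.Adj v v
  digon : ∀ u v, D.Adj u v → ¬ D.Adj v u
  triangle : ∀ a b c, D.Adj a b → D.Adj b c → ¬ D.Adj a c

theorem isTame_of_not_containsCopy {V : Type*} {D : Digraph V} (hloop : D.IsLoopless)
    (hori : D.IsOriented) (htt : ¬ D.ContainsCopy TT3) : IsTame D where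
  loop := hloop
  digon := hori
  triangle a b c hab hbc hac := by
    refine htt ⟨![a, b, c], ?_, ?_⟩
    · have h₁ : a ≠ b := fun h => hloop b (h ▸ hab)
      have h₂ : b ≠ c := fun h => hloop c (h ▸ hbc)
      have h₃ : a ≠ c := fun h => hloop c (h ▸ hac)
      intro i j hij
      fin_cases i <;> fin_cases j <;> simp_all
    · intro i j hij
      simp only [TT3, ofArcs, List.mem_cons, Prod.mk.injEq, List.not_mem_nil, or_false] at hij
      rcases hij with ⟨rfl, rfl⟩ | ⟨rfl, rfl⟩ | ⟨rfl, rfl⟩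
      exacts [hab, hac, hbc]

namespace Represents

variable {V : Type*} {D : Digraph V} {f : ℕ → V} {n : ℕ} {s : InPairs}

theorem cons (h : Represents D f n s) {v p q : ℕ} (hv : v < n) (hp : p < n) (hq : q < n)
    (he : D.inNbr (f v) = {f p, f q}) : Represents D f n ((v, p, q) :: s) where
  inj := h.inj
  record v' p' q' hm := by
    rcases List.mem_cons.1 hm with hm | hm
    · cases hm
      exact ⟨hv, hp, hq, he⟩
    · exact h.record _ _ _ hm

theorem extend (h : Represents D f n s) {a : V} (ha : ∀ i < n, f i ≠ a) :
    Represents D (Function.update f n a) (n + 1) s where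
  inj i hi j hj hij := by
    rcases Nat.lt_succ_iff_lt_or_eq.1 hi with hi | rfl <;>
      rcases Nat.lt_succ_iff_lt_or_eq.1 hj with hj | rfl
    · rw [Function.update_of_ne hi.ne, Function.update_of_ne hj.ne] at hij
      exact h.inj i hi j hj hij
    · rw [Function.update_of_ne hi.ne, Function.update_self] at hij
      exact absurd hij (ha i hi)
    · rw [Function.update_of_ne hj.ne, Function.update_self] at hij
      exact absurd hij.symm (ha j hj)
    · rfl
  record v p q hm := by
    obtain ⟨hv, hp, hq, he⟩ := h.record v p q hm
    rw [Function.update_of_ne hv.ne, Function.update_of_ne hp.ne, Function.update_of_ne hq.ne]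
    exact ⟨hv.trans n.lt_succ_self, hp.trans n.lt_succ_self, hq.trans n.lt_succ_self, he⟩

theorem clashes_eq_false (h : Represents D f n s) (hD : IsTame D) {y p q : ℕ}
    (he : D.inNbr (f y) = {f p, f q}) : clashes s y p q = false := by
  rw [← Bool.not_eq_true]
  intro hc
  have hp : D.Adj (f p) (f y) := by
    have : f p ∈ D.inNbr (f y) := by rw [he]; exact Or.inl rfl
    exact this
  have hq : D.Adj (f q) (f y) := by
    have : f q ∈ D.inNbr (f y) := by rw [he]; exact Or.inr rfl
    exact this
  simp only [clashes, Bool.or_eq_true, isOneOf_iff, anyRecord_iff, Bool.and_eq_true,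
    Nat.beq_eq] at hc
  rcases hc with (rfl | rfl) | ⟨v, a, b, hm, hc⟩
  · exact hD.loop _ hp
  · exact hD.loop _ hq
  have ha := h.adj_left hm
  have hb := h.adj_right hm
  rcases hc with ((⟨rfl, (rfl | rfl) | (rfl | rfl)⟩ | ⟨rfl, (rfl | rfl) | (rfl | rfl)⟩) |
    ⟨rfl, (rfl | rfl) | (rfl | rfl)⟩) | ⟨rfl, (rfl | rfl) | (rfl | rfl)⟩
  · exact hD.digon _ _ ha hp
  · exact hD.digon _ _ hb hp
  · exact hD.triangle _ _ _ ha hp hq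
  · exact hD.triangle _ _ _ hb hp hq
  · exact hD.digon _ _ ha hq
  · exact hD.digon _ _ hb hq
  · exact hD.triangle _ _ _ ha hq hp
  · exact hD.triangle _ _ _ hb hq hp
  · exact hD.digon _ _ ha hp
  · exact hD.digon _ _ ha hq
  · exact hD.triangle _ _ _ hp ha hb
  · exact hD.triangle _ _ _ hq ha hb
  · exact hD.digon _ _ hb hp
  · exact hD.digon _ _ hb hq
  · exact hD.triangle _ _ _ hp hb ha
  · exact hD.triangle _ _ _ hq hb ha

theorem exists_of_forPairs (h : Represents D f n s) (hD : IsTame D) {v p q : ℕ} (hp : p < n)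
    (hq : q < n) (hpq : p ≠ q) (he : D.inNbr (f v) = {f p, f q}) {k : ℕ → ℕ → Bool}
    (hk : forPairs n s v k = true) :
    ∃ p q, p < n ∧ q < n ∧ D.inNbr (f v) = {f p, f q} ∧ k p q = true := by
  wlog hlt : p < q generalizing p q
  · exact this hq hp hpq.symm (he.trans (Set.pair_comm _ _)) (by omega)
  have := allBelow_iff.1 (allBelow_iff.1 hk q hq) p hlt
  rw [h.clashes_eq_false hD he, Bool.false_or] at this
  exact ⟨p, q, hp, hq, he, this⟩

/-- The check is universal, so it can be instantiated at the true in-neighbours of `f v`, labelling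
those that have no label yet. The description of the labelled vertices is exact, so that after three
rounds they form `N⁻[X]`. -/
theorem exists_of_forPairsNew (h : Represents D f n s) (hD : IsTame D) (hreg : D.IsInRegular 2)
    {v : ℕ} (hv : v < n) {k : ℕ → ℕ → ℕ → Bool} (hk : forPairsNew n s v k = true) :
    ∃ f' n' p q, n ≤ n' ∧ (∀ i < n, f' i = f i) ∧ Represents D f' n' ((v, p, q) :: s) ∧
      (∀ u, (∃ i < n', f' i = u) ↔ (∃ i < n, f i = u) ∨ u ∈ D.inNbr (f v)) ∧
      k n' p q = true := by
  simp only [forPairsNew, Bool.and_eq_true] at hk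
  obtain ⟨hold, hone, htwo⟩ := hk
  obtain ⟨a, b, hab, he⟩ := Set.encard_eq_two.1 (hreg (f v))
  have update_lt : ∀ {m i : ℕ} (g : ℕ → V) (c : V), i < m → Function.update g m c i = g i :=
    fun g c hi => Function.update_of_ne hi.ne _ _
  -- Exactly one in-neighbour is already labelled; used for both orders of the pair.
  have mixed : ∀ {a b : V}, D.inNbr (f v) = {a, b} → (∃ i < n, f i = a) → (¬ ∃ i < n, f i = b) →
      ∃ f' n' p q, n ≤ n' ∧ (∀ i < n, f' i = f i) ∧ Represents D f' n' ((v, p, q) :: s) ∧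
      (∀ u, (∃ i < n', f' i = u) ↔ (∃ i < n, f i = u) ∨ u ∈ D.inNbr (f v)) ∧
      k n' p q = true := by
    rintro a b he ⟨p, hp, rfl⟩ hb
    have h' := h.extend (a := b) fun i hi hib => hb ⟨i, hi, hib⟩
    have he' : D.inNbr (Function.update f n b v) =
        {Function.update f n b p, Function.update f n b n} := by
      rw [update_lt _ _ hv, update_lt _ _ hp, Function.update_self, he]
    refine ⟨Function.update f n b, n + 1, p, n, n.le_succ, fun i hi => update_lt _ _ hi,
      h'.cons (by omega) (by omega) (by omega) he', fun u => ?_, ?_⟩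
    · rw [he]
      constructor
      · rintro ⟨i, hi, rfl⟩
        rcases Nat.lt_succ_iff_lt_or_eq.1 hi with hi | rfl
        · exact Or.inl ⟨i, hi, (update_lt _ _ hi).symm⟩
        · right; right; simp
      · rintro (⟨i, hi, rfl⟩ | rfl | rfl)
        · exact ⟨i, by omega, update_lt _ _ hi⟩
        · exact ⟨p, by omega, update_lt _ _ hp⟩
        · exact ⟨n, by omega, Function.update_self ..⟩
    · have := allBelow_iff.1 hone p hp
      rwa [h'.clashes_eq_false hD he', Bool.false_or] at this
  by_cases ha : ∃ i < n, f i = a <;> by_cases hb : ∃ i < n, f i = b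
  · obtain ⟨p, hp, rfl⟩ := ha
    obtain ⟨q, hq, rfl⟩ := hb
    obtain ⟨p, q, hp, hq, he, hk⟩ :=
      h.exists_of_forPairs hD hp hq (fun e => hab (congrArg f e)) he hold
    refine ⟨f, n, p, q, le_rfl, fun _ _ => rfl, h.cons hv hp hq he, fun u => ?_, hk⟩
    rw [he]
    refine ⟨Or.inl, ?_⟩
    rintro (h | rfl | rfl)
    exacts [h, ⟨p, hp, rfl⟩, ⟨q, hq, rfl⟩]
  · exact mixed he ha hb
  · exact mixed (he.trans (Set.pair_comm _ _)) hb ha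
  · have h' := h.extend (a := a) fun i hi hia => ha ⟨i, hi, hia⟩
    have h'' := h'.extend (a := b) fun i hi hib => by
      rcases Nat.lt_succ_iff_lt_or_eq.1 hi with hi | rfl
      · exact hb ⟨i, hi, (update_lt _ _ hi).symm.trans hib⟩
      · exact hab ((Function.update_self ..).symm.trans hib)
    set g := Function.update (Function.update f n a) (n + 1) b with hg
    have g_lt : ∀ i < n, g i = f i := fun i hi => by
      rw [hg, update_lt _ _ (by omega), update_lt _ _ hi]
    have g_n : g n = a := by rw [hg, update_lt _ _ (by omega), Function.update_self]
    have g_succ : g (n + 1) = b := Function.update_self ..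
    refine ⟨g, n + 2, n, n + 1, by omega, g_lt, h''.cons (by omega) (by omega) (by omega) ?_,
      fun u => ?_, htwo⟩
    · rw [g_lt v hv, g_n, g_succ, he]
    · rw [he]
      constructor
      · rintro ⟨i, hi, rfl⟩
        rcases Nat.lt_succ_iff_lt_or_eq.1 hi with hi | rfl
        · rcases Nat.lt_succ_iff_lt_or_eq.1 hi with hi | rfl
          · exact Or.inl ⟨i, hi, (g_lt i hi).symm⟩
          · exact Or.inr (Or.inl g_n)
        · exact Or.inr (Or.inr g_succ)
      · rintro (⟨i, hi, rfl⟩ | rfl | rfl)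
        exacts [⟨i, by omega, g_lt i hi⟩, ⟨n, by omega, g_n⟩, ⟨n + 1, by omega, g_succ⟩]

end Represents

/-! ### Counting the labels still to be covered -/

theorem encard_le_of_forall_mem_inNbr {V : Type*} {D : Digraph V} (hreg : D.IsInRegular 2)
    (R : List V) : ∀ S : Set V, (∀ u ∈ S, ∃ z ∈ R, u ∈ D.inNbr z) →
      S.encard ≤ (2 * R.length : ℕ) := by
  induction R with
  | nil =>
    intro S hS
    have : S = ∅ := Set.eq_empty_of_forall_notMem fun u hu => by simpa using hS u hu
    simp [this]
  | cons z R ih =>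
    intro S hS
    have h₁ : (S ∩ D.inNbr z).encard ≤ 2 :=
      (Set.encard_le_encard Set.inter_subset_right).trans (hreg z).le
    have h₂ : (S \ D.inNbr z).encard ≤ (2 * R.length : ℕ) := by
      refine ih _ fun u hu => ?_
      obtain ⟨w, hw, huw⟩ := hS u hu.1
      rcases List.mem_cons.1 hw with rfl | hw
      exacts [absurd huw hu.2, ⟨w, hw, huw⟩]
    calc S.encard = (S ∩ D.inNbr z ∪ S \ D.inNbr z).encard := by rw [Set.inter_union_sdiff]
      _ ≤ (S ∩ D.inNbr z).encard + (S \ D.inNbr z).encard := Set.encard_union_le _ _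
      _ ≤ 2 + (2 * R.length : ℕ) := add_le_add h₁ h₂
      _ = (2 * (z :: R).length : ℕ) := by
        rw [List.length_cons]; push_cast; ring

/-- The labels in `miss` are distinct, and each of them is an in-neighbour of a vertex in `R`. -/
structure IsCoveredBy {V : Type*} (D : Digraph V) (f : ℕ → V) (n : ℕ) (miss : List ℕ)
    (R : List V) : Prop where
  nodup : miss.Nodup
  covered : ∀ l ∈ miss, l < n ∧ ∃ z ∈ R, f l ∈ D.inNbr z

namespace Represents

variable {V : Type*} {D : Digraph V} {f : ℕ → V} {n : ℕ} {s : InPairs}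

theorem length_le (h : Represents D f n s) (hreg : D.IsInRegular 2) {miss : List ℕ} {R : List V}
    (hm : IsCoveredBy D f n miss R) : miss.length ≤ 2 * R.length := by
  have hinj : Set.InjOn f ↑miss.toFinset := fun i hi j hj hij =>
    h.inj i (hm.covered i (by simpa using hi)).1 j (hm.covered j (by simpa using hj)).1 hij
  have := encard_le_of_forall_mem_inNbr hreg R (f '' ↑miss.toFinset) (by
    rintro _ ⟨l, hl, rfl⟩
    exact (hm.covered l (by simpa using hl)).2)
  rw [hinj.encard_image, Set.encard_coe_eq_coe_finsetCard,
    List.toFinset_card_of_nodup hm.nodup] at this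
  exact_mod_cast this

/-- The true in-neighbours of `f y` pass every pruning test: they do not clash because `D` is tame,
and the labels they leave must be in-neighbours of `R`, hence number at most `2 * R.length`. -/
theorem exists_of_forCovering (h : Represents D f n s) (hD : IsTame D) (hreg : D.IsInRegular 2)
    {y : ℕ} (hy : y < n) (hsub : ∀ u ∈ D.inNbr (f y), ∃ i < n, f i = u) {miss : List ℕ}
    {R : List V} (hm : IsCoveredBy D f n miss (f y :: R)) {k : InPairs → List ℕ → Bool}
    (hk : forCovering n (2 * R.length) y k s miss = true) :
    ∃ s' miss', Represents D f n s' ∧ IsCoveredBy D f n miss' R ∧ k s' miss' = true := by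
  obtain ⟨a, b, hab, he⟩ := Set.encard_eq_two.1 (hreg (f y))
  obtain ⟨p, hp, rfl⟩ := hsub a (by rw [he]; exact Or.inl rfl)
  obtain ⟨q, hq, rfl⟩ := hsub b (by rw [he]; exact Or.inr rfl)
  have hpq : p ≠ q := fun e => hab (congrArg f e)
  clear hab
  wlog hlt : p < q generalizing p q
  · exact this q hq p hp (he.trans (Set.pair_comm _ _)) hpq.symm (by omega)
  have hnot : ∀ {l r : ℕ}, l ≤ r → (!Nat.ble l r) = false := fun h => by
    simpa using h
  have hrem : ∀ (a : ℕ) (l : List ℕ), l.Nodup →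
      l.length ≤ (l.filter fun b => !Nat.beq b a).length + 1 := by
    intro a l hl
    have : (l.filter fun b => !Nat.beq b a) = l.erase a := by
      rw [hl.erase_eq_filter]
      congr 1
      funext b
      rw [Bool.eq_iff_iff, Bool.not_eq_true', ← Bool.not_eq_true, Nat.beq_eq]
      simp
    rw [this, List.length_erase]
    split <;> omega
  have hcov : IsCoveredBy D f n
      ((miss.filter fun l => !Nat.beq l q).filter fun l => !Nat.beq l p) R := by
    refine ⟨(hm.nodup.filter _).filter _, fun l hl => ?_⟩
    simp only [List.mem_filter, Bool.not_eq_true', ← Bool.not_eq_true, Nat.beq_eq] at hl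
    obtain ⟨hln, z, hz, hlz⟩ := hm.covered l hl.1.1
    refine ⟨hln, ?_⟩
    rcases List.mem_cons.1 hz with rfl | hz
    · rw [he] at hlz
      rcases hlz with hlz | hlz
      · exact absurd (h.inj l hln p hp hlz) hl.2
      · exact absurd (h.inj l hln q hq hlz) hl.1.2
    · exact ⟨z, hz, hlz⟩
  have hlen₂ := h.length_le hreg hcov
  have hlen₁ := hrem p _ (hm.nodup.filter fun l => !Nat.beq l q)
  have hlen₀ := hrem q _ hm.nodup
  unfold forCovering at hk
  rw [hnot (by omega), Bool.false_or] at hk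
  have hk := allBelow_iff.1 hk q hq
  have hqy : Nat.beq q y = false := by
    rw [← Bool.not_eq_true, Nat.beq_eq]
    rintro rfl
    have : f q ∈ D.inNbr (f q) := by rw [he]; exact Or.inr rfl
    exact hD.loop _ this
  rw [hqy, Bool.false_or, filterThen_eq, hnot (by omega), Bool.false_or] at hk
  have hk := allBelow_iff.1 hk p hlt
  rw [filterThen_eq, hnot hlen₂, Bool.false_or, h.clashes_eq_false hD he, Bool.false_or] at hk
  exact ⟨_, _, h.cons hy hp hq he, hcov, hk⟩

end Represents

/-! ### Two triples with equal closed in-neighbourhoods -/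

theorem exists_eq_triple_of_card {α : Type*} [DecidableEq α] {X : Finset α} (hX : X.card = 3)
    (w : α → ℕ) : ∃ a b c, a ≠ b ∧ a ≠ c ∧ b ≠ c ∧ X = {a, b, c} ∧ w a ≤ w b ∧ w b ≤ w c := by
  obtain ⟨a, b, c, hab, hac, hbc, rfl⟩ := Finset.card_eq_three.1 hX
  have h₁ : ({a, b, c} : Finset α) = {a, c, b} := by ext; simp; tauto
  have h₂ : ({a, b, c} : Finset α) = {b, a, c} := by ext; simp; tauto
  have h₃ : ({a, b, c} : Finset α) = {b, c, a} := by ext; simp; tauto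
  have h₄ : ({a, b, c} : Finset α) = {c, a, b} := by ext; simp; tauto
  have h₅ : ({a, b, c} : Finset α) = {c, b, a} := by ext; simp; tauto
  rcases le_total (w a) (w b) with h | h <;> rcases le_total (w b) (w c) with h' | h' <;>
    rcases le_total (w a) (w c) with h'' | h''
  · exact ⟨a, b, c, hab, hac, hbc, rfl, h, h'⟩
  · exact ⟨a, b, c, hab, hac, hbc, rfl, h, h'⟩
  · exact ⟨a, c, b, hac, hab, hbc.symm, h₁, h'', h'⟩
  · exact ⟨c, a, b, hac.symm, hbc.symm, hab, h₄, h'', h⟩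
  · exact ⟨b, a, c, hab.symm, hbc, hac, h₂, h, h''⟩
  · exact ⟨b, c, a, hbc, hab.symm, hac.symm, h₃, h', h''⟩
  · exact ⟨c, b, a, hbc.symm, hac.symm, hab.symm, h₅, h', h⟩
  · exact ⟨c, b, a, hbc.symm, hac.symm, hab.symm, h₅, h', h⟩

/-- A set of three vertices among `f 0, …, f (n - 1)` has increasing labels. -/
theorem exists_labels_of_card {V : Type*} [DecidableEq V] {f : ℕ → V} {n : ℕ} {Y : Finset V}
    (hY : Y.card = 3) (hf : ∀ y ∈ Y, ∃ i < n, f i = y) :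
    ∃ i j k, i < j ∧ j < k ∧ k < n ∧ Y = {f i, f j, f k} := by
  obtain ⟨a, b, c, hab, hac, hbc, rfl⟩ := Finset.card_eq_three.1 hY
  obtain ⟨i, hi, rfl⟩ := hf a (by simp)
  obtain ⟨j, hj, rfl⟩ := hf b (by simp)
  obtain ⟨k, hk, rfl⟩ := hf c (by simp)
  have hij : i ≠ j := fun e => hab (congrArg f e)
  have hik : i ≠ k := fun e => hac (congrArg f e)
  have hjk : j ≠ k := fun e => hbc (congrArg f e)
  obtain ⟨i', j', k', -, -, -, he, h₁, h₂⟩ := exists_eq_triple_of_card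
    (X := {i, j, k}) (by rw [Finset.card_eq_three]; exact ⟨i, j, k, hij, hik, hjk, rfl⟩) id
  have hcard : ({i', j', k'} : Finset ℕ).card = 3 := by
    rw [← he, Finset.card_eq_three]; exact ⟨i, j, k, hij, hik, hjk, rfl⟩
  have hlt : ∀ l ∈ ({i', j', k'} : Finset ℕ), l < n := by
    rw [← he]
    simp [hi, hj, hk]
  have h₁' : i' ≠ j' := by
    rintro rfl
    have := Finset.card_le_two (a := i') (b := k')
    simp at hcard
    omega
  have h₂' : j' ≠ k' := by
    rintro rfl
    have := Finset.card_le_two (a := i') (b := j')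
    simp at hcard
    omega
  refine ⟨i', j', k', lt_of_le_of_ne h₁ h₁', lt_of_le_of_ne h₂ h₂', hlt _ (by simp), ?_⟩
  have := congrArg (Finset.image f) he
  simpa [Finset.image_insert] using this

section Triples

variable {V : Type*} {D : Digraph V}

theorem mem_closedInNbrs {X : Finset V} {u : V} :
    u ∈ D.closedInNbrs ↑X ↔ ∃ x ∈ X, u = x ∨ D.Adj u x := by
  simp [Digraph.closedInNbrs, Digraph.closedInNbr, Digraph.inNbr]

/-- The invariant of a vertex that is computed by `weight`. -/
theorem exists_weight (hreg : D.IsInRegular 2) (X Y : Finset V) :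
    ∃ w : V → ℕ, ∀ (f : ℕ → V) (x p q y₁ y₂ y₃ : ℕ), D.inNbr (f x) = {f p, f q} →
      (f x ∈ Y ↔ isOneOfThree x y₁ y₂ y₃ = true) →
      (f p ∈ X ↔ isOneOfThree p 0 1 2 = true) → (f p ∈ Y ↔ isOneOfThree p y₁ y₂ y₃ = true) →
      (f q ∈ X ↔ isOneOfThree q 0 1 2 = true) → (f q ∈ Y ↔ isOneOfThree q y₁ y₂ y₃ = true) →
      weight x p q y₁ y₂ y₃ = w (f x) := by
  classical
  choose g h hne hN using fun v => Set.encard_eq_two.1 (hreg v)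
  -- The base-3 digits of the weight are: membership in `Y`, the number of in-neighbours in `X`, the
  -- number in `Y`. No labelling enters, so `X` can be sorted by weight before labels are assigned.
  let c : V → ℕ := fun u => (if u ∈ X then 3 else 0) + (if u ∈ Y then 1 else 0)
  refine ⟨fun v => (if v ∈ Y then 9 else 0) + (c (g v) + c (h v)), ?_⟩
  intro f x p q y₁ y₂ y₃ he hx hp hp' hq hq'
  have hc : c (f p) + c (f q) = c (g (f x)) + c (h (f x)) := by
    rw [hN, Set.pair_eq_pair_iff] at he
    rcases he with ⟨h₁, h₂⟩ | ⟨h₁, h₂⟩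
    · rw [h₁, h₂]
    · rw [h₁, h₂, add_comm]
  show _ = (if f x ∈ Y then 9 else 0) + (c (g (f x)) + c (h (f x)))
  rw [← hc]
  simp only [c, hx, hp, hp', hq, hq', weight, Bool.cond_eq_ite]

theorem Represents.containsForbidden_of_chooseTriple (hD : IsTame D) (hreg : D.IsInRegular 2)
    {f : ℕ → V} {n p₀ q₀ p₁ q₁ p₂ q₂ : ℕ}
    (h : Represents D f n [(2, p₂, q₂), (1, p₁, q₁), (0, p₀, q₀)])
    {y₁ y₂ y₃ : ℕ} (h₁₂ : y₁ < y₂) (h₂₃ : y₂ < y₃) (h₃ : y₃ < n) (hne : y₃ ≠ 2)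
    (hw₁ : weight 0 p₀ q₀ y₁ y₂ y₃ ≤ weight 1 p₁ q₁ y₁ y₂ y₃)
    (hw₂ : weight 1 p₁ q₁ y₁ y₂ y₃ ≤ weight 2 p₂ q₂ y₁ y₂ y₃)
    (hY : ∀ u, (∃ i < n, f i = u) ↔
      ∃ y ∈ [y₁, y₂, y₃], u = f y ∨ D.Adj u (f y))
    (hk : chooseTriple n p₀ q₀ p₁ q₁ p₂ q₂ = true) : ContainsForbidden D := by
  have hk := allBelow_iff.1 (allBelow_iff.1 (allBelow_iff.1 hk y₃ h₃) y₂ h₂₃) y₁ h₁₂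
  have hne' : Nat.beq y₃ 2 = false := by rwa [← Bool.not_eq_true, Nat.beq_eq]
  have hw₁' : (!Nat.ble (weight 0 p₀ q₀ y₁ y₂ y₃) (weight 1 p₁ q₁ y₁ y₂ y₃)) = false := by
    simpa using hw₁
  have hw₂' : (!Nat.ble (weight 1 p₁ q₁ y₁ y₂ y₃) (weight 2 p₂ q₂ y₁ y₂ y₃)) = false := by
    simpa using hw₂
  rw [hne', hw₁', hw₂', Bool.false_or, Bool.false_or, Bool.false_or, filterThen_eq] at hk
  have hsub : ∀ y ∈ [y₁, y₂, y₃], ∀ u ∈ D.inNbr (f y), ∃ i < n, f i = u := fun y hy u hu =>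
    (hY u).2 ⟨y, hy, Or.inr hu⟩
  have hlt : ∀ y ∈ [y₁, y₂, y₃], y < n := by
    simp only [List.mem_cons, List.not_mem_nil, or_false]
    omega
  -- `R` needs only the vertices with label at least 3: what the others cover is recorded and
  -- already filtered out by `isUncovered`.
  have hcov : ∀ R : List V, (∀ y ∈ [y₁, y₂, y₃], 3 ≤ y → f y ∈ R) → IsCoveredBy D f n
      ((List.range n).filter (isUncovered [(2, p₂, q₂), (1, p₁, q₁), (0, p₀, q₀)] y₁ y₂ y₃)) R := by
    intro R hR
    refine ⟨List.nodup_range.filter _, fun l hl => ?_⟩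
    rw [List.mem_filter, List.mem_range, isUncovered, Bool.and_eq_true, Bool.not_eq_true',
      Bool.not_eq_true', ← Bool.not_eq_true, ← Bool.not_eq_true, isOneOfThree_iff,
      anyRecord_iff] at hl
    obtain ⟨hln, hly, hrec⟩ := hl
    refine ⟨hln, ?_⟩
    obtain ⟨y, hy, hly' | hadj⟩ := (hY (f l)).1 ⟨l, hln, rfl⟩
    · refine absurd ?_ hly
      rw [h.inj l hln y (hlt y hy) hly']
      simpa using hy
    · by_cases h3 : 3 ≤ y
      · exact ⟨f y, hR y hy h3, hadj⟩
      · exfalso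
        have hrec' : ∃ p q, (y, p, q) ∈ [(2, p₂, q₂), (1, p₁, q₁), (0, p₀, q₀)] := by
          have : y = 0 ∨ y = 1 ∨ y = 2 := by omega
          rcases this with rfl | rfl | rfl <;> simp
        obtain ⟨p, q, hm⟩ := hrec'
        obtain ⟨-, hp, hq, he⟩ := h.record _ _ _ hm
        refine hrec ⟨y, p, q, hm, ?_⟩
        rw [Bool.and_eq_true, isOneOfThree_iff, isOneOf_iff]
        refine ⟨by simpa using hy, ?_⟩
        have hl : f l ∈ D.inNbr (f y) := hadj
        rw [he] at hl
        exact hl.imp (h.inj l hln p hp) (h.inj l hln q hq)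
  have last : ∀ {s : InPairs} {miss : List ℕ}, Represents D f n s →
      IsCoveredBy D f n miss [f y₃] →
      forCovering n 0 y₃ (fun s _ => findForbidden n s) s miss = true → ContainsForbidden D := by
    intro s miss h hm hk
    obtain ⟨s', _, h', -, hk⟩ := h.exists_of_forCovering hD hreg (R := []) h₃
      (hsub _ (by simp)) hm hk
    exact containsForbidden_of_findForbidden h' hk
  have lastTwo : ∀ {s : InPairs} {miss : List ℕ}, Represents D f n s →
      IsCoveredBy D f n miss [f y₂, f y₃] →
      forCovering n 2 y₂ (forCovering n 0 y₃ fun s _ => findForbidden n s) s miss = true →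
      ContainsForbidden D := by
    intro s miss h hm hk
    obtain ⟨s', _, h', hm', hk⟩ := h.exists_of_forCovering hD hreg (R := [f y₃])
      (hlt _ (by simp)) (hsub _ (by simp)) hm hk
    exact last h' hm' hk
  cases hb₁ : Nat.ble 3 y₁ with
  | true =>
    rw [hb₁, cond_true] at hk
    obtain ⟨s', _, h', hm', hk⟩ := h.exists_of_forCovering hD hreg (R := [f y₂, f y₃])
      (hlt _ (by simp)) (hsub _ (by simp)) (hcov _ (by simp)) hk
    exact lastTwo h' hm' hk
  | false =>
    have hy₁ : ¬ 3 ≤ y₁ := by rwa [← Nat.ble_eq, Bool.not_eq_true]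
    rw [hb₁, cond_false] at hk
    cases hb₂ : Nat.ble 3 y₂ with
    | true =>
      rw [hb₂, cond_true] at hk
      exact lastTwo h (hcov _ (by simp [hy₁])) hk
    | false =>
      have hy₂ : ¬ 3 ≤ y₂ := by rwa [← Nat.ble_eq, Bool.not_eq_true]
      rw [hb₂, cond_false] at hk
      exact last h (hcov _ (by simp [hy₁, hy₂])) hk

/-- Two distinct triples with the same closed in-neighbourhood yield a forbidden digraph. -/
theorem containsForbidden_of_closedInNbrs_eq (hD : IsTame D) (hreg : D.IsInRegular 2)
    {X Y : Finset V} (hX : X.card = 3) (hY : Y.card = 3) (hne : X ≠ Y)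
    (he : D.closedInNbrs ↑X = D.closedInNbrs ↑Y) : ContainsForbidden D := by
  classical
  obtain ⟨w, hw⟩ := exists_weight hreg X Y
  obtain ⟨a, b, c, hab, hac, hbc, rfl, hwab, hwbc⟩ := exists_eq_triple_of_card hX w
  let f₀ : ℕ → V := fun i => if i = 0 then a else if i = 1 then b else c
  have h₀ : Represents D f₀ 3 [] := by
    refine ⟨fun i hi j hj hij => ?_, by simp⟩
    interval_cases i <;> interval_cases j <;> simp_all [f₀]
  obtain ⟨f₁, n₁, p₀, q₀, hn₁, hf₁, h₁, him₁, hk⟩ :=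
    h₀.exists_of_forPairsNew hD hreg (by omega) checkTriples_eq_true
  obtain ⟨f₂, n₂, p₁, q₁, hn₂, hf₂, h₂, him₂, hk⟩ :=
    h₁.exists_of_forPairsNew hD hreg (by omega) hk
  obtain ⟨f, n, p₂, q₂, hn, hf, h, him, hk⟩ :=
    h₂.exists_of_forPairsNew hD hreg (by omega) hk
  have h₁0 : f₁ 0 = a := hf₁ 0 (by omega)
  have h₁1 : f₁ 1 = b := hf₁ 1 (by omega)
  have h₁2 : f₁ 2 = c := hf₁ 2 (by omega)
  have h₂0 : f₂ 0 = a := (hf₂ 0 (by omega)).trans h₁0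
  have h₂1 : f₂ 1 = b := (hf₂ 1 (by omega)).trans h₁1
  have h₂2 : f₂ 2 = c := (hf₂ 2 (by omega)).trans h₁2
  have hf0 : f 0 = a := (hf 0 (by omega)).trans h₂0
  have hf1 : f 1 = b := (hf 1 (by omega)).trans h₂1
  have hf2 : f 2 = c := (hf 2 (by omega)).trans h₂2
  have him₀ : ∀ u, (∃ i < 3, f₀ i = u) ↔ u = a ∨ u = b ∨ u = c := by
    intro u
    constructor
    · rintro ⟨i, hi, rfl⟩
      interval_cases i <;> simp [f₀]
    · rintro (rfl | rfl | rfl)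
      exacts [⟨0, by omega, rfl⟩, ⟨1, by omega, rfl⟩, ⟨2, by omega, rfl⟩]
  -- The labelled vertices are exactly `N⁻[X] = N⁻[Y]`, so `Y` and its in-neighbours are all
  -- labelled.
  have hmem : ∀ u, (∃ i < n, f i = u) ↔ u ∈ D.closedInNbrs ↑({a, b, c} : Finset V) := by
    intro u
    rw [him, him₂, him₁, him₀, mem_closedInNbrs, h₂2, h₁1]
    simp only [Digraph.inNbr, Set.mem_ofPred_eq, Finset.mem_insert, Finset.mem_singleton,
      exists_eq_or_imp, exists_eq_left, show f₀ 0 = a from rfl]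
    tauto
  obtain ⟨y₁, y₂, y₃, hy₁₂, hy₂₃, hy₃, rfl⟩ := exists_labels_of_card (f := f) (n := n) hY
    fun y hy => (hmem y).2 (by rw [he, mem_closedInNbrs]; exact ⟨y, hy, Or.inl rfl⟩)
  have hXl : ∀ i < n, f i ∈ ({a, b, c} : Finset V) ↔ isOneOfThree i 0 1 2 = true := by
    intro i hi
    rw [isOneOfThree_iff, ← hf0, ← hf1, ← hf2]
    simp only [Finset.mem_insert, Finset.mem_singleton]
    refine ⟨fun hi' => hi'.imp (h.inj _ hi _ (by omega)) (Or.imp (h.inj _ hi _ (by omega))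
      (h.inj _ hi _ (by omega))), ?_⟩
    rintro (rfl | rfl | rfl) <;> simp
  have hYl : ∀ i < n, f i ∈ ({f y₁, f y₂, f y₃} : Finset V) ↔
      isOneOfThree i y₁ y₂ y₃ = true := by
    intro i hi
    rw [isOneOfThree_iff]
    simp only [Finset.mem_insert, Finset.mem_singleton]
    refine ⟨fun hi' => hi'.imp (h.inj _ hi _ (by omega)) (Or.imp (h.inj _ hi _ (by omega))
      (h.inj _ hi _ (by omega))), ?_⟩
    rintro (rfl | rfl | rfl) <;> simp
  have hweight : ∀ x p q, (x, p, q) ∈ [(2, p₂, q₂), (1, p₁, q₁), (0, p₀, q₀)] →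
      weight x p q y₁ y₂ y₃ = w (f x) := by
    intro x p q hm
    obtain ⟨hx, hp, hq, hN⟩ := h.record x p q hm
    exact hw f x p q y₁ y₂ y₃ hN (hYl x hx) (hXl p hp) (hYl p hp) (hXl q hq) (hYl q hq)
  refine h.containsForbidden_of_chooseTriple hD hreg hy₁₂ hy₂₃ hy₃ ?_ ?_ ?_ (fun u => ?_) hk
  · rintro rfl
    obtain rfl : y₂ = 1 := by omega
    obtain rfl : y₁ = 0 := by omega
    exact hne (by rw [hf0, hf1, hf2])
  · rwa [hweight 0 p₀ q₀ (by simp), hweight 1 p₁ q₁ (by simp), hf0, hf1]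
  · rwa [hweight 1 p₁ q₁ (by simp), hweight 2 p₂ q₂ (by simp), hf1, hf2]
  · rw [hmem, he, mem_closedInNbrs]
    simp

end Triples

/-! ### Sets with at most two elements, and sufficiency -/

section Characterization

variable {V : Type*} {D : Digraph V}

/-- If the closed in-neighbourhood of `y` is covered by two other vertices, then there is a copy
of `J1`. -/
theorem containsCopy_J1_of_subset_pair (hD : IsTame D) (hreg : D.IsInRegular 2) {a b y : V}
    (hya : y ≠ a) (hyb : y ≠ b)
    (hsub : ∀ u, u = y ∨ D.Adj u y → (u = a ∨ D.Adj u a) ∨ (u = b ∨ D.Adj u b)) :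
    D.ContainsCopy J1 := by
  wlog hadj : D.Adj y a generalizing a b
  · refine this hyb hya (fun u hu => (hsub u hu).symm) ?_
    rcases hsub y (Or.inl rfl) with (h | h) | (h | h)
    exacts [absurd h hya, absurd h hadj, absurd h hyb, h]
  obtain ⟨p, q, hpq, hN⟩ := Set.encard_eq_two.1 (hreg y)
  have hmem : ∀ u, D.Adj u y ↔ u = p ∨ u = q := fun u => by
    have : u ∈ D.inNbr y ↔ u ∈ ({p, q} : Set V) := by rw [hN]
    exact this
  have hp := (hmem p).2 (Or.inl rfl)
  have hq := (hmem q).2 (Or.inr rfl)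
  -- An in-neighbour `u` of `y` is not in `N⁻[a]`: together with `y → a`, `u = a` gives a digon and
  -- `u → a` a transitive triangle.
  have key : ∀ u, D.Adj u y → u = b ∨ D.Adj u b := by
    intro u hu
    rcases hsub u (Or.inr hu) with (rfl | h) | h
    · exact absurd hu (hD.digon _ _ hadj)
    · exact absurd h (hD.triangle _ _ _ hu hadj)
    · exact h
  have hpb : D.Adj p b := by
    rcases key p hp with rfl | h
    · rcases key q hq with rfl | h
      · exact absurd rfl hpq
      · exact absurd hq (hD.triangle _ _ _ h hp)
    · exact h
  have hqb : D.Adj q b := by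
    rcases key q hq with rfl | h
    · exact absurd hp (hD.triangle _ _ _ hpb hq)
    · exact h
  have hbN : ∀ u, D.Adj u b → u = p ∨ u = q := by
    obtain ⟨p', q', hpq', hN'⟩ := Set.encard_eq_two.1 (hreg b)
    have hmem' : ∀ u, D.Adj u b ↔ u = p' ∨ u = q' := fun u => by
      have : u ∈ D.inNbr b ↔ u ∈ ({p', q'} : Set V) := by rw [hN']
      exact this
    intro u hu
    rw [hmem'] at hu hpb hqb
    grind
  have ne_of_adj : ∀ {u v}, D.Adj u v → u ≠ v := fun h e => hD.loop _ (e ▸ h)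
  have hab : b ≠ a := by
    rintro rfl
    exact hD.loop y ((hmem y).2 (hbN y hadj))
  have hap : a ≠ p := by rintro rfl; exact hD.digon _ _ hadj hp
  have haq : a ≠ q := by rintro rfl; exact hD.digon _ _ hadj hq
  have h₁ := ne_of_adj hp
  have h₂ := ne_of_adj hq
  have h₃ := ne_of_adj hpb
  have h₄ := ne_of_adj hqb
  refine ⟨[y, b, a, p, q].get, ?_, ?_⟩
  · have hl : [y, b, a, p, q].Nodup := by
      simp only [List.nodup_cons, List.mem_cons, List.not_mem_nil, or_false, not_or,
        not_false_eq_true, List.nodup_nil, and_true]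
      exact ⟨⟨hyb, hya, h₁.symm, h₂.symm⟩, ⟨hab, h₃.symm, h₄.symm⟩, ⟨hap, haq⟩, hpq⟩
    exact List.nodup_iff_injective_get.1 hl
  · intro i j hij
    simp only [J1, ofArcs, List.mem_cons, Prod.mk.injEq, List.not_mem_nil, or_false] at hij
    rcases hij with ⟨rfl, rfl⟩ | ⟨rfl, rfl⟩ | ⟨rfl, rfl⟩ | ⟨rfl, rfl⟩ | ⟨rfl, rfl⟩
    exacts [hp, hq, hpb, hqb, hadj]

/-- If `N⁻[X] = N⁻[Y]` and `Y` has at most two elements, then `X ⊆ Y`, or there is a copy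
of `J1`. -/
theorem subset_of_card_le_two (hD : IsTame D) (hreg : D.IsInRegular 2)
    (hJ : ¬ D.ContainsCopy J1) {X Y : Finset V} (hY₁ : 1 ≤ Y.card) (hY₂ : Y.card ≤ 2)
    (he : D.closedInNbrs ↑X = D.closedInNbrs ↑Y) : X ⊆ Y := by
  classical
  intro x hx
  by_contra hxY
  -- A singleton is written with `a = b`.
  obtain ⟨a, b, rfl⟩ : ∃ a b, Y = {a, b} := by
    have : Y.card = 1 ∨ Y.card = 2 := by omega
    rcases this with h | h
    · obtain ⟨a, rfl⟩ := Finset.card_eq_one.1 h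
      exact ⟨a, a, by simp⟩
    · obtain ⟨a, b, -, rfl⟩ := Finset.card_eq_two.1 h
      exact ⟨a, b, rfl⟩
  simp only [Finset.mem_insert, Finset.mem_singleton, not_or] at hxY
  refine hJ (containsCopy_J1_of_subset_pair hD hreg hxY.1 hxY.2 fun u hu => ?_)
  have : u ∈ D.closedInNbrs ↑({a, b} : Finset V) := by
    rw [← he, mem_closedInNbrs]
    exact ⟨x, hx, hu⟩
  rw [mem_closedInNbrs] at this
  simpa using this

theorem hasIdentifyingCode_of_not_containsForbidden (hD : IsTame D) (hreg : D.IsInRegular 2)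
    (hJ : ¬ ContainsForbidden D) : D.HasIdentifyingCode 3 := by
  refine ⟨Set.univ, fun X Y hne hX₁ hX₃ hY₁ hY₃ he => ?_⟩
  rw [Set.inter_univ, Set.inter_univ] at he
  have hJ₁ : ¬ D.ContainsCopy J1 := fun h => hJ (Or.inl h)
  by_cases hY₂ : Y.card ≤ 2
  · have hXY := subset_of_card_le_two hD hreg hJ₁ hY₁ hY₂ he
    have hX₂ := (Finset.card_le_card hXY).trans hY₂
    exact hne (hXY.antisymm (subset_of_card_le_two hD hreg hJ₁ hX₁ hX₂ he.symm))
  by_cases hX₂ : X.card ≤ 2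
  · have hYX := subset_of_card_le_two hD hreg hJ₁ hX₁ hX₂ he.symm
    exact hY₂ ((Finset.card_le_card hYX).trans hX₂)
  exact hJ (containsForbidden_of_closedInNbrs_eq hD hreg (by omega) (by omega) hne he)

/-! ### Necessity -/

theorem not_hasIdentifyingCode_of_closedInNbrs_eq {ℓ : ℕ} {X Y : Finset V} (hne : X ≠ Y)
    (hX₁ : 1 ≤ X.card) (hX : X.card ≤ ℓ) (hY₁ : 1 ≤ Y.card) (hY : Y.card ≤ ℓ)
    (he : D.closedInNbrs ↑X = D.closedInNbrs ↑Y) : ¬ D.HasIdentifyingCode ℓ :=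
  fun ⟨_, hC⟩ => hC X Y hne hX₁ hX hY₁ hY (by rw [he])

/-- If the closed in-neighbourhood of `v` is covered by two other vertices, then `D` has no
identifying code. -/
theorem not_hasIdentifyingCode_of_subset_pair {a b v : V} (hva : v ≠ a) (hvb : v ≠ b)
    (hsub : ∀ u, u = v ∨ D.Adj u v → (u = a ∨ D.Adj u a) ∨ (u = b ∨ D.Adj u b)) :
    ¬ D.HasIdentifyingCode 3 := by
  classical
  refine not_hasIdentifyingCode_of_closedInNbrs_eq (X := {a, b}) (Y := {v, a, b}) ?_
    (Finset.card_pos.2 ⟨a, by simp⟩) (Finset.card_le_two.trans (by omega))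
    (Finset.card_pos.2 ⟨a, by simp⟩) Finset.card_le_three ?_
  · intro h
    have : v ∈ ({a, b} : Finset V) := by rw [h]; simp
    simp [hva, hvb] at this
  · ext u
    have := hsub u
    simp only [mem_closedInNbrs, Finset.mem_insert, Finset.mem_singleton, exists_eq_or_imp,
      exists_eq_left]
    tauto

theorem exists_inNbr_pair (hreg : D.IsInRegular 2) {u v : V} (h : D.Adj u v) :
    ∃ w, ∀ x, D.Adj x v ↔ x = u ∨ x = w := by
  obtain ⟨p, q, hpq, hN⟩ := Set.encard_eq_two.1 (hreg v)
  have hmem : ∀ x, D.Adj x v ↔ x = p ∨ x = q := fun x => by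
    have : x ∈ D.inNbr v ↔ x ∈ ({p, q} : Set V) := by rw [hN]
    exact this
  rcases (hmem u).1 h with rfl | rfl
  · exact ⟨q, hmem⟩
  · exact ⟨p, fun x => (hmem x).trans or_comm⟩

theorem forall_adj_of_two (hreg : D.IsInRegular 2) {p q v : V} (hpq : p ≠ q) (hp : D.Adj p v)
    (hq : D.Adj q v) {x : V} (hx : D.Adj x v) : x = p ∨ x = q := by
  obtain ⟨w, hw⟩ := exists_inNbr_pair hreg hp
  rcases (hw q).1 hq with rfl | rfl
  exacts [absurd rfl hpq, (hw x).1 hx]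

theorem isOriented_of_hasIdentifyingCode (hloop : D.IsLoopless) (hreg : D.IsInRegular 2)
    (hC : D.HasIdentifyingCode 3) : D.IsOriented := by
  intro u v huv hvu
  obtain ⟨w, hw⟩ := exists_inNbr_pair hreg huv
  have hwv : v ≠ w := by
    rintro rfl
    exact hloop _ ((hw _).2 (Or.inr rfl))
  have huv' : v ≠ u := by
    rintro rfl
    exact hloop _ huv
  -- `N⁻[v] = {v, u, w}`, where `v, u ∈ N⁻[u]` and `w ∈ N⁻[w]`.
  refine not_hasIdentifyingCode_of_subset_pair huv' hwv (fun x hx => ?_) hC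
  rw [hw] at hx
  rcases hx with rfl | rfl | rfl
  exacts [Or.inl (Or.inr hvu), Or.inl (Or.inl rfl), Or.inr (Or.inl rfl)]

theorem not_containsCopy_TT3_of_hasIdentifyingCode (hreg : D.IsInRegular 2)
    (hloop : D.IsLoopless) (hC : D.HasIdentifyingCode 3) : ¬ D.ContainsCopy TT3 := by
  rintro ⟨f, hf, hA⟩
  have h₀₁ : D.Adj (f 0) (f 1) := hA 0 1 (by simp [TT3, ofArcs])
  have h₀₂ : D.Adj (f 0) (f 2) := hA 0 2 (by simp [TT3, ofArcs])
  have h₁₂ : D.Adj (f 1) (f 2) := hA 1 2 (by simp [TT3, ofArcs])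
  obtain ⟨w, hw⟩ := exists_inNbr_pair hreg h₀₁
  have hne : f 1 ≠ w := by
    intro h
    exact hloop _ ((hw _).2 (Or.inr h))
  -- `N⁻[f 1] = {f 1, f 0, w}`, where the first two lie in `N⁻[f 2]`.
  refine not_hasIdentifyingCode_of_subset_pair (a := f 2) (b := w) (hf.ne (by decide)) hne
    (fun x hx => ?_) hC
  rw [hw] at hx
  rcases hx with rfl | rfl | rfl
  exacts [Or.inl (Or.inr h₁₂), Or.inl (Or.inr h₀₂), Or.inr (Or.inl rfl)]

/-- In the digraph with arcs `l`, the vertices in `X \ Y` have in-degree at least two, and two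
in-neighbours are, together with the vertex itself, in the closed in-neighbourhood of `Y`. -/
def IsAbsorbed {n : ℕ} (l : List (Fin n × Fin n)) (X Y : Finset (Fin n)) : Prop :=
  ∀ v ∈ X, v ∈ Y ∨ ∃ d ∈ l, ∃ e ∈ l, d.2 = v ∧ e.2 = v ∧ d.1 ≠ e.1 ∧
    ∀ u ∈ [v, d.1, e.1], u ∈ Y ∨ ∃ a ∈ l, a.1 = u ∧ a.2 ∈ Y

instance {n : ℕ} (l : List (Fin n × Fin n)) (X Y : Finset (Fin n)) :
    Decidable (IsAbsorbed l X Y) := by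
  unfold IsAbsorbed
  infer_instance

/-- Further arcs of `D` do no harm: a vertex outside `Y` shows both its in-neighbours in the
pattern, and additional arcs into `Y` only enlarge the right-hand side. -/
theorem IsAbsorbed.closedInNbrs_subset (hreg : D.IsInRegular 2) {n : ℕ}
    {l : List (Fin n × Fin n)} {X Y : Finset (Fin n)} (h : IsAbsorbed l X Y) {f : Fin n ↪ V}
    (hA : ∀ a b, (a, b) ∈ l → D.Adj (f a) (f b)) :
    D.closedInNbrs ↑(X.map f) ⊆ D.closedInNbrs ↑(Y.map f) := by
  intro u hu
  simp only [mem_closedInNbrs, Finset.mem_map, exists_exists_and_eq_and] at hu ⊢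
  obtain ⟨v, hv, huv⟩ := hu
  rcases h v hv with hvY | ⟨⟨p, v'⟩, hp, ⟨q, v''⟩, hq, hv', hv'', hpq, hcov⟩
  · exact ⟨v, hvY, huv⟩
  obtain rfl : v' = v := hv'
  obtain rfl : v'' = v' := hv''
  have key : ∀ x ∈ [v'', p, q], ∃ a ∈ Y, f x = f a ∨ D.Adj (f x) (f a) := by
    intro x hx
    rcases hcov x hx with hxY | ⟨⟨_, w⟩, ha, rfl, hw⟩
    exacts [⟨x, hxY, Or.inl rfl⟩, ⟨w, hw, Or.inr (hA _ _ ha)⟩]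
  rcases huv with rfl | huv
  · exact key _ (by simp)
  · rcases forall_adj_of_two hreg (f.injective.ne hpq) (hA _ _ hp) (hA _ _ hq) huv with rfl | rfl
    exacts [key p (by simp), key q (by simp)]

/-- A digraph with arcs `l` in which two sets of at most three vertices absorb each other is not
contained in a digraph with an identifying code. -/
theorem not_containsCopy_of_isAbsorbed (hreg : D.IsInRegular 2) (hC : D.HasIdentifyingCode 3)
    {n : ℕ} {l : List (Fin n × Fin n)} (X Y : Finset (Fin n)) (hne : X ≠ Y) (hX₁ : 1 ≤ X.card)
    (hX : X.card ≤ 3) (hY₁ : 1 ≤ Y.card) (hY : Y.card ≤ 3) (hXY : IsAbsorbed l X Y)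
    (hYX : IsAbsorbed l Y X) : ¬ D.ContainsCopy (ofArcs l) := by
  rintro ⟨f, hf, hA⟩
  refine not_hasIdentifyingCode_of_closedInNbrs_eq (X := X.map ⟨f, hf⟩) (Y := Y.map ⟨f, hf⟩)
    (by simpa using hne) ?_ ?_ ?_ ?_ ?_ hC
  · rwa [Finset.card_map]
  · rwa [Finset.card_map]
  · rwa [Finset.card_map]
  · rwa [Finset.card_map]
  · exact (hXY.closedInNbrs_subset hreg (f := ⟨f, hf⟩) hA).antisymm
      (hYX.closedInNbrs_subset hreg (f := ⟨f, hf⟩) hA)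

theorem not_containsForbidden_of_hasIdentifyingCode (hreg : D.IsInRegular 2)
    (hC : D.HasIdentifyingCode 3) : ¬ ContainsForbidden D := by
  have key {n : ℕ} {l : List (Fin n × Fin n)} (X Y : Finset (Fin n))
      (h : X ≠ Y ∧ 1 ≤ X.card ∧ X.card ≤ 3 ∧ 1 ≤ Y.card ∧ Y.card ≤ 3 ∧ IsAbsorbed l X Y ∧
        IsAbsorbed l Y X) : ¬ D.ContainsCopy (ofArcs l) :=
    not_containsCopy_of_isAbsorbed hreg hC X Y h.1 h.2.1 h.2.2.1 h.2.2.2.1 h.2.2.2.2.1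
      h.2.2.2.2.2.1 h.2.2.2.2.2.2
  rintro (h | h | h | h | h | h | h | h | h | h | h | h | h | h | h)
  · exact key {0, 1, 2} {1, 2} (by decide) h
  · exact key {0, 2, 3} {1, 2, 3} (by decide) h
  · exact key {0, 2, 3} {1, 2, 3} (by decide) h
  · exact key {0, 2, 3} {1, 2, 3} (by decide) h
  · exact key {0, 1, 3} {0, 2, 3} (by decide) h
  · exact key {0, 1, 3} {0, 2, 3} (by decide) h
  · exact key {0, 1, 3} {0, 2, 3} (by decide) h
  · exact key {0, 2, 3} {1, 2, 3} (by decide) h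
  · exact key {0, 2, 3} {1, 2, 3} (by decide) h
  · exact key {0, 1, 3} {0, 2, 3} (by decide) h
  · exact key {0, 1, 3} {0, 2, 3} (by decide) h
  · exact key {0, 1, 2} {0, 2, 3} (by decide) h
  · exact key {0, 1, 2} {3, 4, 5} (by decide) h
  · exact key {0, 1, 2} {3, 4, 5} (by decide) h
  · exact key {0, 1, 2} {3, 4, 5} (by decide) h

end Characterization

end InRegularCode

theorem theorem5 {V : Type*} (D : Digraph V) (hloop : D.IsLoopless) (hreg : D.IsInRegular 2) :
    D.HasIdentifyingCode 3 ↔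
      (¬ D.ContainsCopy InRegularCode.TT3 ∧ D.IsOriented) ∧
      ¬ D.ContainsCopy InRegularCode.J1 ∧
      ¬ D.ContainsCopy InRegularCode.J2 ∧
      ¬ D.ContainsCopy InRegularCode.J3 ∧
      ¬ D.ContainsCopy InRegularCode.J4 ∧
      ¬ D.ContainsCopy InRegularCode.J5 ∧
      ¬ D.ContainsCopy InRegularCode.J6 ∧
      ¬ D.ContainsCopy InRegularCode.J7 ∧
      ¬ D.ContainsCopy InRegularCode.J8 ∧
      ¬ D.ContainsCopy InRegularCode.J9 ∧
      ¬ D.ContainsCopy InRegularCode.J10 ∧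
      ¬ D.ContainsCopy InRegularCode.J11 ∧
      ¬ D.ContainsCopy InRegularCode.J12 ∧
      ¬ D.ContainsCopy InRegularCode.J13 ∧
      ¬ D.ContainsCopy InRegularCode.J14 ∧
      ¬ D.ContainsCopy InRegularCode.J15 := by
  have hiff : D.HasIdentifyingCode 3 ↔ (¬ D.ContainsCopy InRegularCode.TT3 ∧ D.IsOriented) ∧
      ¬ InRegularCode.ContainsForbidden D := by
    constructor
    · exact fun hC => ⟨⟨InRegularCode.not_containsCopy_TT3_of_hasIdentifyingCode hreg hloop hC,
        InRegularCode.isOriented_of_hasIdentifyingCode hloop hreg hC⟩,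
        InRegularCode.not_containsForbidden_of_hasIdentifyingCode hreg hC⟩
    · exact fun h => InRegularCode.hasIdentifyingCode_of_not_containsForbidden
        (InRegularCode.isTame_of_not_containsCopy hloop h.1.2 h.1.1) hreg h.2
  rw [hiff]
  simp only [InRegularCode.ContainsForbidden, not_or]
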